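/- Let $k$ be an algebraically closed field, $X$ an integral projective scheme over $k$, $\sigma$ a $k$-automorphism of $X$, and $\mathcal L$ an invertible sheaf on $X$. Let $Z\subseteq X$ be a closed subscheme that is zero-dimensional or empty, with ideal sheaf $\mathcal I$ and support $S$, and assume that each $p\in S$ has infinite order under $\sigma$. For a sheaf $\mathcal F$ on $X$ write $\mathcal F^{\sigma}=\sigma^*\mathcal F$; put $\mathcal I_n=\mathcal I\,\mathcal I^{\sigma}\cdots\mathcal I^{\sigma^{n-1}}$ and $\mathcal L_n=\mathcal L\otimes\mathcal L^{\sigma}\otimes\cdots\otimes\mathcal L^{\sigma^{n-1}}$, and let $$\mathcal R=\mathcal R(X,Z,\mathcal L,\sigma)=\bigoplus_{n\ge 0}{}_1(\mathcal E_n)_{\sigma^n},\qquad \mathcal E_n=\mathcal I_n\otimes\mathcal L_n,$$ be the graded $(\mathcal O_X,\sigma)$-bimodule algebra with the natural multiplication $\mathcal E_n\otimes\mathcal E_m^{\sigma^n}\to\mathcal E_{n+m}$. A (graded) right ideal of $\mathcal R$ is a family $\mathcal G=(\mathcal G_n)_{n\ge0}$ of quasi-coherent subsheaves $\mathcal G_n\subseteq\mathcal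 E_n$ such that the multiplication maps $\mathcal G_n\otimes\mathcal E_m^{\sigma^n}$ into $\mathcal G_{n+m}$ for all $n,m$; a (graded) left ideal is such a family for which $\mathcal E_m\otimes\mathcal G_n^{\sigma^m}$ is mapped into $\mathcal G_{m+n}$ for all $n,m$. A right (left) ideal, or a factor of one right ideal by a smaller one, is coherent if it is generated as a right (left) $\mathcal R$-module by a coherent $\mathcal O_X$-submodule, i.e. if it is the image of $\mathcal M_0\otimes\mathcal R$ (respectively $\mathcal R\otimes\mathcal M_0$) for some coherent $\mathcal O_X$-module $\mathcal M_0$. The algebra $\mathcal R$ is right (left) noetherian if every right (left) ideal is coherent, and noetherian if it is both. A factor of right ideals is torsion if each of its coherent graded submodules vanishes in all but finitely many degrees. A set $C$ of closed points of $X$ is critically dense if it is infinite and every infinite subset of $C$ is Zariski dense in $X$. The subscheme $Z$ is right saturating if $\{\sigma^{-i}(c): i\ge0\}$ is critically dense for every $c\in S$, and saturating if $\{\sigma^{-i}(c): i\in\mathbb Z\}$ is critically dense for every $c\in S$; in particular the empty subscheme is saturating. Then: 1. $\mathcal R$ is right noetherian if and only if $Z$ is right saturating, and $\mathcal R$ is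 noetherian if and only if $Z$ is saturating. 2. If $\mathcal R$ is not right noetherian, there is an infinite ascending chain $\mathcal M^0\subseteq\mathcal M^1\subseteq\mathcal M^2\subseteq\cdots$ of coherent right ideals of $\mathcal R$ such that no factor $\mathcal M^{n+1}/\mathcal M^n$ is torsion. -/

import Mathlib

open CategoryTheory AlgebraicGeometry
open scoped Pointwise

universe u

namespace NaiveBlowup

section Projective

attribute [local instance] MvPolynomial.gradedAlgebra

/-- Projective `N`-space over `k`, with its structure morphism. -/
noncomputable def projSpaceToSpec (k : Type u) [Field k] (N : ℕ) :
    Proj (MvPolynomial.homogeneousSubmodule (Fin (N + 1)) k) ⟶ Spec (CommRingCat.of k) :=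
  Proj.toSpecZero (MvPolynomial.homogeneousSubmodule (Fin (N + 1)) k) ≫
    Spec.map (CommRingCat.ofHom
      (algebraMap k (MvPolynomial.homogeneousSubmodule (Fin (N + 1)) k 0)))

/-- A `k`-scheme is projective if it is a closed subscheme of some projective space over `k`. -/
def IsProjective {k : Type u} [Field k] {X : Scheme.{u}} (f : X ⟶ Spec (CommRingCat.of k)) :
    Prop :=
  ∃ (N : ℕ) (i : X ⟶ Proj (MvPolynomial.homogeneousSubmodule (Fin (N + 1)) k)),
    IsClosedImmersion i ∧ i ≫ projSpaceToSpec k N = f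

end Projective

section Points

variable {X : Scheme.{u}}

/-- The permutation of the points of `X` given by an automorphism. -/
noncomputable def pointPerm (σ : X ≅ X) : Equiv.Perm X := (Scheme.homeoOfIso σ).toEquiv

/-- A set of points is critically dense if it is infinite and each of its infinite subsets is
Zariski dense. -/
def CriticallyDense (C : Set X) : Prop :=
  C.Infinite ∧ ∀ D ⊆ C, D.Infinite → closure D = Set.univ

/-- The closed subscheme cut out by `I` is right saturating: `{σ⁻ⁱ(c) : i ≥ 0}` is critically
dense for every `c` in its support. -/
def RightSaturating (σ : X ≅ X) (I : X.IdealSheafData) : Prop :=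
  ∀ c ∈ I.support, CriticallyDense {x : X | ∃ i : ℕ, x = (pointPerm σ ^ (-(i : ℤ))) c}

/-- The closed subscheme cut out by `I` is saturating: `{σ⁻ⁱ(c) : i ∈ ℤ}` is critically
dense for every `c` in its support. -/
def Saturating (σ : X ≅ X) (I : X.IdealSheafData) : Prop :=
  ∀ c ∈ I.support, CriticallyDense {x : X | ∃ i : ℤ, x = (pointPerm σ ^ (-i)) c}

end Points

/-- An `𝒪_X`-module is invertible if it is locally isomorphic to the structure sheaf. -/
def IsInvertible {X : Scheme.{u}} (L : X.Modules) : Prop :=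
  ∀ x : X, ∃ U : X.Opens, x ∈ U ∧
    Nonempty (L.restrict U.ι ≅ SheafOfModules.unit (U : Scheme.{u}).ringCatSheaf)

lemma IsInvertible.exists_generator {X : Scheme.{u}} {L : X.Modules} (hL : IsInvertible L) (x : X) :
    ∃ (U : X.Opens) (u : Γ(L, U)), x ∈ U ∧ ∀ (V : X.Opens) (h : V ≤ U),
      Function.Bijective fun r : Γ(X, V) => r • L.presheaf.map (homOfLE h).op u := by
  obtain ⟨U, hx, ⟨φ⟩⟩ := hL x
  let F : (U : Scheme.{u}).Modules := SheafOfModules.unit (U : Scheme.{u}).ringCatSheaf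
  obtain ⟨ψ, hψ⟩ : ∃ ψ : F ⟶ L.restrict U.ι, IsIso ψ := ⟨φ.inv, inferInstance⟩
  let o (V : (U : Scheme.{u}).Opens) : Γ(F, V) := (1 : Γ((U : Scheme.{u}), V))
  let e : Γ(L.restrict U.ι, ⊤) := ψ.app ⊤ (o ⊤)
  refine ⟨U.ι ''ᵁ ⊤, e, by simpa using hx, fun V h => ?_⟩
  obtain ⟨V', rfl⟩ : ∃ V' : (U : Scheme.{u}).Opens, V = U.ι ''ᵁ V' := by
    refine ⟨U.ι ⁻¹ᵁ V, ?_⟩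
    rw [Scheme.Opens.ι_image_top] at h
    rw [Scheme.Hom.image_preimage_eq_opensRange_inf, Scheme.Opens.opensRange_ι, inf_eq_right.2 h]
  let i : V' ⟶ ⊤ := homOfLE le_top
  have h1 : ψ.app V' (o V') = (L.restrict U.ι).presheaf.map i.op e := by
    have h2 : F.presheaf.map i.op (o ⊤) = o V' := map_one ((U : Scheme.{u}).presheaf.map i.op).hom
    rw [← h2]
    exact ConcreteCategory.congr_hom (ψ.mapPresheaf.naturality i.op) _
  have key (r : Γ(X, U.ι ''ᵁ V')) : r • L.presheaf.map (homOfLE h).op e =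
      ψ.app V' ((U.ι.appIso V').hom r : Γ((U : Scheme.{u}), V')) := by
    let a : Γ((U : Scheme.{u}), V') := (U.ι.appIso V').hom r
    have h3 : a • o V' = a := mul_one a
    have h4 := (ψ.app_smul a (o V')).symm.trans (congrArg (ψ.app V') h3)
    refine Eq.trans ?_ h4
    rw [h1]
    change _ = (U.ι.appIso V').inv ((U.ι.appIso V').hom r) • L.presheaf.map (homOfLE h).op e
    congr 1
    exact (ConcreteCategory.congr_hom (U.ι.appIso V').hom_inv_id r).symm
  have b1 : Function.Bijective (ψ.app V') := ConcreteCategory.bijective_of_isIso (ψ.app V')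
  have b2 : Function.Bijective (U.ι.appIso V').hom :=
    ConcreteCategory.bijective_of_isIso (U.ι.appIso V').hom
  rw [funext key]
  exact b1.comp b2

variable {X : Scheme.{u}} [IsIntegral X]

/-- A family of `𝒪_{X,x}`-submodules of the function field `K` of `X`, one for each point `x`.
A subsheaf of `𝒪_X`-modules `F` of the constant sheaf `K` is recorded by the family of its stalks;
its sections are `F(U) = {f ∈ K : f ∈ F x for all x ∈ U}`. Inclusions, sums and products of
subsheaves are computed pointwise. -/
abbrev FracSub (X : Scheme.{u}) [IsIntegral X] : Type u :=
  ∀ x : X, Submodule (X.presheaf.stalk x) X.functionField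

/-- The stalks of a quasi-coherent `𝒪_X`-submodule of the constant sheaf `K`: locally on `X`
there is a set of sections which generates all the stalks. -/
def IsQCoh (F : FracSub X) : Prop :=
  ∀ x : X, ∃ U : X.Opens, x ∈ U ∧ ∃ T : Set X.functionField,
    ∀ y ∈ U, F y = Submodule.span (X.presheaf.stalk y) T

/-- The stalks of a quasi-coherent `𝒪_X`-submodule of finite type of the constant sheaf `K`.
If `X` is locally noetherian, these are the coherent submodules. -/
def IsCoh (F : FracSub X) : Prop :=
  ∀ x : X, ∃ U : X.Opens, x ∈ U ∧ ∃ T : Set X.functionField, T.Finite ∧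
    ∀ y ∈ U, F y = Submodule.span (X.presheaf.stalk y) T

/-- The action `f ↦ f^σ`, `f^σ(x) = f(σ(x))`, of an automorphism `σ` on rational functions. -/
noncomputable def funPullback (σ : X ≅ X) : X.functionField →+* X.functionField :=
  (X.presheaf.stalkSpecializes
      (specializes_of_eq (genericPoint_eq_of_isOpenImmersion σ.hom)) ≫
    σ.hom.stalkMap (genericPoint X)).hom

/-- The pullback `F^σ = σ^*F` of a subsheaf of `K`, again as a subsheaf of `K`. -/
noncomputable def twist (σ : X ≅ X) (F : FracSub X) : FracSub X := fun x =>
  Submodule.span (X.presheaf.stalk x) (funPullback σ '' (F (σ.hom x) : Set X.functionField))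


lemma funPullback_algebraMap (σ : X ≅ X) (x : X) (a : X.presheaf.stalk (σ.hom x)) :
    funPullback σ (algebraMap _ X.functionField a) =
      algebraMap (X.presheaf.stalk x) X.functionField (σ.hom.stalkMap x a) := by
  have h := σ.hom.stalkSpecializes_stalkMap_apply (genericPoint X) x
    (genericPoint_specializes x) a
  change (σ.hom.stalkMap (genericPoint X)) ((X.presheaf.stalkSpecializes _)
    ((X.presheaf.stalkSpecializes _) a)) = (X.presheaf.stalkSpecializes _) (σ.hom.stalkMap x a)
  rw [← h]
  congr 1
  exact ConcreteCategory.congr_hom (X.presheaf.stalkSpecializes_comp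
    (specializes_of_eq (genericPoint_eq_of_isOpenImmersion σ.hom))
    (genericPoint_specializes (σ.hom x))) a

lemma twist_eq_span (σ : X ≅ X) (F : FracSub X) (x : X) (T : Set X.functionField)
    (h : F (σ.hom x) = Submodule.span _ T) :
    twist σ F x = Submodule.span _ (funPullback σ '' T) := by
  apply le_antisymm
  · apply Submodule.span_le.2
    rintro _ ⟨f, hf, rfl⟩
    rw [h] at hf
    induction hf using Submodule.span_induction with
    | mem f hf => exact Submodule.subset_span ⟨f, hf, rfl⟩
    | zero => simp
    | add f g _ _ hf hg => rw [map_add]; exact Submodule.add_mem _ hf hg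
    | smul a f _ hf =>
      rw [Algebra.smul_def, map_mul, funPullback_algebraMap, ← Algebra.smul_def]
      exact Submodule.smul_mem _ _ hf
  · apply Submodule.span_mono
    rw [h]
    exact Set.image_mono Submodule.subset_span

lemma twist_mono (σ : X ≅ X) : Monotone (twist σ : FracSub X → FracSub X) := fun _ _ h x =>
  Submodule.span_mono (Set.image_mono (h (σ.hom x)))

lemma twist_mul (σ : X ≅ X) (F G : FracSub X) : twist σ (F * G) = twist σ F * twist σ G := by
  funext x
  have h : (F * G) (σ.hom x) = Submodule.span _
      ((F (σ.hom x) : Set X.functionField) * (G (σ.hom x) : Set X.functionField)) := by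
    rw [← Submodule.span_mul_span, Submodule.span_eq, Submodule.span_eq, Pi.mul_apply]
  rw [twist_eq_span σ (F * G) x _ h, Set.image_mul]
  exact (Submodule.span_mul_span _ _ _).symm

lemma twist_one (σ : X ≅ X) : twist σ (1 : FracSub X) = 1 := by
  funext x
  rw [twist_eq_span σ 1 x {1} Submodule.one_eq_span]
  simpa using Submodule.one_eq_span.symm

lemma isQCoh_one : IsQCoh (1 : FracSub X) := fun _ =>
  ⟨⊤, trivial, {1}, fun _ _ => Submodule.one_eq_span⟩

lemma isQCoh_bot : IsQCoh (⊥ : FracSub X) := fun _ =>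
  ⟨⊤, trivial, ∅, fun _ _ => by simp⟩

lemma IsQCoh.mul {F G : FracSub X} (hF : IsQCoh F) (hG : IsQCoh G) : IsQCoh (F * G) := fun x => by
  obtain ⟨U, hU, S, hS⟩ := hF x
  obtain ⟨V, hV, T, hT⟩ := hG x
  refine ⟨U ⊓ V, ⟨hU, hV⟩, S * T, fun y hy => ?_⟩
  rw [Pi.mul_apply, hS y hy.1, hT y hy.2, Submodule.span_mul_span]

lemma IsQCoh.twist {F : FracSub X} (hF : IsQCoh F) (σ : X ≅ X) : IsQCoh (twist σ F) := fun x => by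
  obtain ⟨U, hU, T, hT⟩ := hF (σ.hom x)
  exact ⟨σ.hom ⁻¹ᵁ U, hU, funPullback σ '' T, fun y hy => twist_eq_span σ F y T (hT _ hy)⟩

/-- The ideal sheaf `I ⊆ 𝒪_X` as a subsheaf of `K`. -/
noncomputable def ofIdealSheaf (I : X.IdealSheafData) : FracSub X := fun x =>
  Submodule.span (X.presheaf.stalk x)
    {f | ∃ (U : X.affineOpens) (hx : x ∈ U.1), ∃ a ∈ I.ideal U,
      f = algebraMap (X.presheaf.stalk x) X.functionField (X.presheaf.germ U.1 x hx a)}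

/-- Let `L` be an invertible sheaf and `s ≠ 0` a section of `L` over an open set `W`, in other words
a rational section. This is `L` as a subsheaf of `K`, via `t ↦ t / s`: the local sections are
the rational functions `f` for which `f s` is a regular section of `L`. -/
noncomputable def ofInvertible (L : X.Modules) {W : X.Opens} (s : Γ(L, W)) : FracSub X := fun x =>
  Submodule.span (X.presheaf.stalk x)
    {f | ∃ (U : X.Opens) (t : Γ(L, U)), x ∈ U ∧
      ∃ (V : X.Opens) (hU : V ≤ U) (hW : V ≤ W) (hη : genericPoint X ∈ V) (g : Γ(X, V)),
        X.presheaf.germ V (genericPoint X) hη g = f ∧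
        L.presheaf.map (homOfLE hU).op t = g • L.presheaf.map (homOfLE hW).op s}

lemma isQCoh_ofIdealSheaf (I : X.IdealSheafData) : IsQCoh (ofIdealSheaf I) := fun x => by
  obtain ⟨_, ⟨U, hU, rfl⟩, hxU, -⟩ :=
    X.isBasis_affineOpens.exists_subset_of_mem_open (Set.mem_univ x) isOpen_univ
  have : Nonempty U := ⟨⟨x, hxU⟩⟩
  refine ⟨U, hxU, X.germToFunctionField U '' (I.ideal ⟨U, hU⟩ : Set Γ(X, U)), fun y hy => ?_⟩
  apply le_antisymm
  · apply Submodule.span_le.2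
    rintro _ ⟨V, hyV, a, ha, rfl⟩
    obtain ⟨_, ⟨W, hW, rfl⟩, hyW, hWUV⟩ :=
      X.isBasis_affineOpens.exists_subset_of_mem_open (show y ∈ (U ⊓ V.1 : X.Opens) from ⟨hy, hyV⟩)
        (U ⊓ V.1).isOpen
    have hWU : W ≤ U := fun z hz => (hWUV hz).1
    have hWV : W ≤ V.1 := fun z hz => (hWUV hz).2
    have : Nonempty W := ⟨⟨y, hyW⟩⟩
    have h1 : X.presheaf.map (homOfLE hWV).op a ∈ I.ideal ⟨W, hW⟩ := by
      rw [← I.map_ideal (U := ⟨W, hW⟩) (V := V) hWV]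
      exact Ideal.mem_map_of_mem _ ha
    rw [← I.map_ideal (U := ⟨W, hW⟩) (V := ⟨U, hU⟩) hWU] at h1
    rw [← X.presheaf.germ_res_apply (homOfLE hWV) y hyW a]
    generalize X.presheaf.map (homOfLE hWV).op a = b at h1
    change b ∈ Submodule.span _ _ at h1
    induction h1 using Submodule.span_induction with
    | mem b hb =>
      obtain ⟨c, hc, rfl⟩ := hb
      refine Submodule.subset_span ⟨c, hc, ?_⟩
      rw [← Scheme.algebraMap_germ_eq_germToFunctionField X hy]
      exact congr_arg _ (X.presheaf.germ_res_apply (homOfLE hWU) y hyW c).symm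
    | zero => simp
    | add b c _ _ hb hc => rw [map_add, map_add]; exact Submodule.add_mem _ hb hc
    | smul r b _ hb =>
      rw [smul_eq_mul, map_mul, map_mul, ← Algebra.smul_def]
      exact Submodule.smul_mem _ _ hb
  · apply Submodule.span_mono
    rintro _ ⟨a, ha, rfl⟩
    exact ⟨⟨U, hU⟩, hy, a, ha, (Scheme.algebraMap_germ_eq_germToFunctionField X hy a).symm⟩

lemma isQCoh_ofInvertible {L : X.Modules} (hL : IsInvertible L) {W : X.Opens} (s : Γ(L, W)) :
    IsQCoh (ofInvertible L s) := fun x => by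
  obtain ⟨U, u, hxU, hu⟩ := hL.exists_generator x
  have res {V₁ V₂ V₃ : X.Opens} (h : V₁ ≤ V₂) (h' : V₂ ≤ V₃) (t : Γ(L, V₃)) :
      L.presheaf.map (homOfLE h).op (L.presheaf.map (homOfLE h').op t) =
        L.presheaf.map (homOfLE (h.trans h')).op t := by
    rw [← ConcreteCategory.comp_apply, ← Functor.map_comp]
    rfl
  refine ⟨U, hxU, {f | ∃ (t : Γ(L, U)) (V : X.Opens) (hU : V ≤ U) (hW : V ≤ W)
    (hη : genericPoint X ∈ V) (g : Γ(X, V)), X.presheaf.germ V (genericPoint X) hη g = f ∧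
      L.presheaf.map (homOfLE hU).op t = g • L.presheaf.map (homOfLE hW).op s}, fun y hy => ?_⟩
  apply le_antisymm
  · apply Submodule.span_le.2
    rintro f ⟨U', t', hyU', V', hU', hW', hη, g', rfl, htg⟩
    have hηU : genericPoint X ∈ U := (genericPoint_specializes y).mem_open U.isOpen hy
    -- pass to a common open set, on which `s = h u`
    obtain ⟨h, hh⟩ := (hu (V' ⊓ U) inf_le_right).2 (L.presheaf.map
      (homOfLE ((inf_le_left : V' ⊓ U ≤ V').trans hW')).op s)
    have hη0 : genericPoint X ∈ V' ⊓ U := ⟨hη, hηU⟩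
    have ht0 : L.presheaf.map (homOfLE ((inf_le_left : V' ⊓ U ≤ V').trans hU')).op t' =
        X.presheaf.map (homOfLE (inf_le_left : V' ⊓ U ≤ V')).op g' •
          L.presheaf.map (homOfLE ((inf_le_left : V' ⊓ U ≤ V').trans hW')).op s := by
      rw [← res inf_le_left hU', htg, Scheme.Modules.map_smul, res]
    by_cases h0 : h = 0
    · refine Submodule.subset_span ⟨0, V' ⊓ U, inf_le_right, inf_le_left.trans hW', hη0,
        X.presheaf.map (homOfLE inf_le_left).op g', X.presheaf.germ_res_apply _ _ _ _, ?_⟩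
      rw [← hh, h0]
      simp
    · obtain ⟨r, hr⟩ := (hu (U' ⊓ U) inf_le_right).2 (L.presheaf.map (homOfLE inf_le_left).op t')
      let V₁ := X.basicOpen h
      have hV₁ : V₁ ≤ V' ⊓ U := X.basicOpen_le h
      have hη1 : genericPoint X ∈ V₁ := by
        refine ((genericPoint_spec X).mem_open_set_iff V₁.isOpen).2 ?_
        rw [Set.univ_inter]
        by_contra hne
        refine h0 ((basicOpen_eq_bot_iff h).1 (TopologicalSpace.Opens.ext ?_))
        exact Set.not_nonempty_iff_eq_empty.1 hne
      have hunit : IsUnit (X.presheaf.map (homOfLE hV₁).op h) :=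
        RingedSpace.isUnit_res_basicOpen X.toRingedSpace h
      obtain ⟨v, hv⟩ := hunit.exists_left_inv
      have hη2 : genericPoint X ∈ U' ⊓ U := ⟨hU' hη, hηU⟩
      -- `v` represents `u / s`
      have hmem : X.presheaf.germ V₁ (genericPoint X) hη1 v ∈ Submodule.span (X.presheaf.stalk y)
          {f | ∃ (t : Γ(L, U)) (V : X.Opens) (hU : V ≤ U) (hW : V ≤ W)
            (hη : genericPoint X ∈ V) (g : Γ(X, V)),
            X.presheaf.germ V (genericPoint X) hη g = f ∧
            L.presheaf.map (homOfLE hU).op t = g • L.presheaf.map (homOfLE hW).op s} := by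
        refine Submodule.subset_span ⟨u, V₁, hV₁.trans inf_le_right,
          (hV₁.trans inf_le_left).trans hW', hη1, v, rfl, ?_⟩
        rw [← res hV₁ (inf_le_left.trans hW'), ← hh, Scheme.Modules.map_smul, res, smul_smul, hv,
          one_smul]
      have hgh : X.presheaf.map (homOfLE (inf_le_left : V' ⊓ U ≤ V')).op g' * h =
          X.presheaf.map (homOfLE (inf_le_inf_right U hU')).op r := by
        apply (hu (V' ⊓ U) inf_le_right).1
        change (_ * h) • _ = _
        rw [mul_smul]
        have hh' : h • L.presheaf.map (homOfLE (inf_le_right : V' ⊓ U ≤ U)).op u = _ := hh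
        rw [hh', ← ht0, ← res (inf_le_inf_right U hU') inf_le_left, ← hr,
          Scheme.Modules.map_smul, res]
      have hf : X.presheaf.germ V' (genericPoint X) hη g' =
          X.presheaf.germ (U' ⊓ U) (genericPoint X) hη2 r *
            X.presheaf.germ V₁ (genericPoint X) hη1 v := by
        have e1 := congrArg (X.presheaf.germ (V' ⊓ U) (genericPoint X) hη0) hgh
        have e2 := congrArg (X.presheaf.germ V₁ (genericPoint X) hη1) hv
        rw [map_mul, X.presheaf.germ_res_apply, X.presheaf.germ_res_apply] at e1
        rw [map_mul, X.presheaf.germ_res_apply, map_one] at e2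
        rw [← e1, mul_assoc, mul_comm (X.presheaf.germ (V' ⊓ U) _ _ h), e2, mul_one]
      have hr' : X.presheaf.germ (U' ⊓ U) (genericPoint X) hη2 r =
          algebraMap (X.presheaf.stalk y) X.functionField
            (X.presheaf.germ (U' ⊓ U) y ⟨hyU', hy⟩ r) :=
        have : Nonempty (U' ⊓ U : X.Opens) := ⟨⟨y, hyU', hy⟩⟩
        (Scheme.algebraMap_germ_eq_germToFunctionField X (U := U' ⊓ U) (x := y) ⟨hyU', hy⟩ r).symm
      rw [SetLike.mem_coe, hf, hr', ← Algebra.smul_def]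
      exact Submodule.smul_mem _ _ hmem
  · apply Submodule.span_mono
    rintro _ ⟨t, V, hU, hW, hη, g, rfl, htg⟩
    exact ⟨U, t, hy, V, hU, hW, hη, g, rfl, htg⟩

/-- A graded `(𝒪_X, σ)`-bimodule algebra `⨁ₙ ₁(Eₙ)_{σⁿ}` whose components are quasi-coherent
subsheaves of `K`, with `E₀ = 𝒪_X`, and whose multiplication `Eₙ ⊗ Eₘ^{σⁿ} → Eₙ₊ₘ` is
`a ⊗ b^{σⁿ} ↦ a b^{σⁿ}`, i.e. it is induced by that of the skew polynomial ring `K[t; σ]`. -/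
structure BimoduleAlgebra (σ : X ≅ X) where
  /-- The sheaf `Eₙ`. -/
  part : ℕ → FracSub X
  isQCoh_part : ∀ n, IsQCoh (part n)
  part_zero : part 0 = 1
  part_mul_le : ∀ n m, part n * (twist σ)^[n] (part m) ≤ part (n + m)

/-- The product `F F^σ ⋯ F^{σ^{n-1}}`. -/
noncomputable def twistedPow (σ : X ≅ X) (F : FracSub X) (n : ℕ) : FracSub X :=
  ∏ i ∈ Finset.range n, (twist σ)^[i] F

lemma iterate_twist_mul (σ : X ≅ X) (F G : FracSub X) (n : ℕ) :
    (twist σ)^[n] (F * G) = (twist σ)^[n] F * (twist σ)^[n] G := by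
  induction n generalizing F G with
  | zero => rfl
  | succ n ih => simp only [Function.iterate_succ_apply, twist_mul, ih]

lemma twistedPow_add (σ : X ≅ X) (F : FracSub X) (n m : ℕ) :
    twistedPow σ F n * (twist σ)^[n] (twistedPow σ F m) = twistedPow σ F (n + m) := by
  have key : (twist σ)^[n] (twistedPow σ F m) =
      ∏ i ∈ Finset.range m, (twist σ)^[n + i] F := by
    induction m with
    | zero => simpa [twistedPow] using Function.iterate_fixed (twist_one σ) n
    | succ m ih =>
      rw [twistedPow, Finset.prod_range_succ, Finset.prod_range_succ, iterate_twist_mul,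
        ← Function.iterate_add_apply, ← ih]
      rfl
  rw [key, twistedPow, twistedPow, Finset.prod_range_add]

lemma IsQCoh.twistedPow {F : FracSub X} (hF : IsQCoh F) (σ : X ≅ X) (n : ℕ) :
    IsQCoh (twistedPow σ F n) := by
  have key : ∀ i, IsQCoh ((NaiveBlowup.twist σ)^[i] F) := fun i => by
    induction i with
    | zero => exact hF
    | succ i ih => rw [Function.iterate_succ_apply']; exact ih.twist σ
  induction n with
  | zero => simpa [NaiveBlowup.twistedPow] using isQCoh_one
  | succ n ih =>
    rw [NaiveBlowup.twistedPow, Finset.prod_range_succ]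
    exact ih.mul (key n)

/-- The bimodule algebra `𝓡(X, Z, L, σ) = ⨁ₙ ₁(Iₙ ⊗ Lₙ)_{σⁿ}`, where `I` is the ideal sheaf of `Z`,
`Iₙ = I I^σ ⋯ I^{σ^{n-1}}` and `Lₙ = L ⊗ L^σ ⊗ ⋯ ⊗ L^{σ^{n-1}}`. A nonzero rational section `s` of
`L` identifies `L` with a subsheaf of `K`, hence `Lₙ`, by means of the rational section
`s ⊗ s^σ ⊗ ⋯ ⊗ s^{σ^{n-1}}`, with the product of the twists of this subsheaf. Since `Lₙ` is
invertible, `Iₙ ⊗ Lₙ = Iₙ Lₙ`. -/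
noncomputable def naiveBlowup (σ : X ≅ X) (I : X.IdealSheafData) (L : X.Modules)
    (hL : IsInvertible L) {W : X.Opens} (s : Γ(L, W)) : BimoduleAlgebra σ where
  part n := twistedPow σ (ofIdealSheaf I) n * twistedPow σ (ofInvertible L s) n
  isQCoh_part n :=
    ((isQCoh_ofIdealSheaf I).twistedPow σ n).mul ((isQCoh_ofInvertible hL s).twistedPow σ n)
  part_zero := by simp [twistedPow]
  part_mul_le n m := by
    rw [iterate_twist_mul, mul_mul_mul_comm, twistedPow_add, twistedPow_add]

variable {σ : X ≅ X}

/-- A graded right ideal `⨁ₙ ₁(Gₙ)_{σⁿ}` of a bimodule algebra. -/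
structure RightIdeal (B : BimoduleAlgebra σ) where
  /-- The sheaf `Gₙ`. -/
  part : ℕ → FracSub X
  isQCoh_part : ∀ n, IsQCoh (part n)
  part_le : ∀ n, part n ≤ B.part n
  part_mul_le : ∀ n m, part n * (twist σ)^[n] (B.part m) ≤ part (n + m)

/-- A graded left ideal `⨁ₙ ₁(Gₙ)_{σⁿ}` of a bimodule algebra. -/
structure LeftIdeal (B : BimoduleAlgebra σ) where
  /-- The sheaf `Gₙ`. -/
  part : ℕ → FracSub X
  isQCoh_part : ∀ n, IsQCoh (part n)
  part_le : ∀ n, part n ≤ B.part n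
  mul_part_le : ∀ n m, B.part m * (twist σ)^[m] (part n) ≤ part (m + n)

namespace RightIdeal

variable {B : BimoduleAlgebra σ}

instance : LE (RightIdeal B) := ⟨fun G H => ∀ n, G.part n ≤ H.part n⟩

noncomputable instance : Bot (RightIdeal B) := ⟨
  { part := fun _ => ⊥
    isQCoh_part := fun _ => isQCoh_bot
    part_le := fun _ => bot_le
    part_mul_le := fun _ _ x => by simp }⟩

/-- For right ideals `N ≤ P`, the factor `P / N` is a coherent right module: there is a coherent
sheaf `C = ⨁_{i ≤ d} Cᵢ`, with `Cᵢ` in degree `i`, such that `C ⊗ B → P / N` is surjective. -/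
def FactorIsCoherent (N P : RightIdeal B) : Prop :=
  ∃ (d : ℕ) (C : ℕ → FracSub X), (∀ i, IsCoh (C i) ∧ C i ≤ P.part i) ∧
    ∀ n, P.part n =
      N.part n ⊔ ⨆ (i : ℕ) (j : ℕ) (_ : i ≤ d ∧ i + j = n), C i * (twist σ)^[i] (B.part j)

/-- The right ideal `P` is coherent as a right module. -/
def IsCoherent (P : RightIdeal B) : Prop := FactorIsCoherent ⊥ P

/-- For right ideals `N ≤ P`, the factor `P / N` is torsion: each of its coherent submodules `Q / N`
is bounded, i.e. is zero in all but finitely many degrees. -/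
def FactorIsTorsion (N P : RightIdeal B) : Prop :=
  ∀ Q : RightIdeal B, N ≤ Q → Q ≤ P → FactorIsCoherent N Q →
    {n : ℕ | Q.part n ≠ N.part n}.Finite

end RightIdeal

/-- The left ideal `P` is coherent as a left module: there is a coherent sheaf `C = ⨁_{i ≤ d} Cᵢ`,
with `Cᵢ` in degree `i`, such that `B ⊗ C → P` is surjective. -/
def LeftIdeal.IsCoherent {B : BimoduleAlgebra σ} (P : LeftIdeal B) : Prop :=
  ∃ (d : ℕ) (C : ℕ → FracSub X), (∀ i, IsCoh (C i) ∧ C i ≤ P.part i) ∧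
    ∀ n, P.part n = ⨆ (i : ℕ) (j : ℕ) (_ : i ≤ d ∧ j + i = n), B.part j * (twist σ)^[j] (C i)

/-- Every right ideal is coherent. -/
def IsRightNoetherian (B : BimoduleAlgebra σ) : Prop := ∀ P : RightIdeal B, P.IsCoherent

/-- Every left ideal is coherent. -/
def IsLeftNoetherian (B : BimoduleAlgebra σ) : Prop := ∀ P : LeftIdeal B, P.IsCoherent

/-- Left and right noetherian. -/
def IsNoetherian (B : BimoduleAlgebra σ) : Prop := IsLeftNoetherian B ∧ IsRightNoetherian B

end NaiveBlowup

/-! The invertible sheaf is harmless: multiplying degree `n` by the inverse of `Lₙ` turns graded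
right ideals of `𝓡` into sequences of ideal sheaves `Jₙ ⊆ Iₙ` with `Jₙ I^{σⁿ} ⊆ Jₙ₊₁`
(`stabilizes_mul_iff`). Such a right ideal is coherent exactly when equality holds for all large
`n`, and `Stabilizes` says that this happens for every `J`.

Critical density gives stabilization (`stabilizes_of_criticallyDense`). If `J_a ≠ 0`, its zero locus
`Y` is a proper closed set. Off `Y` the stalk of `J_a` is `𝒪`, which squeezes `J_{a+n}` to the
product `I^{σ^a} ⋯ I^{σ^{a+n-1}}`. The ideal `I^{σⁿ}` is supported on `σ⁻ⁿ(S)`, and by critical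
density only finitely many of these sets meet `Y`. So along `Y` the ideals `Jₙ` eventually just
ascend, and the ascending chain condition for ideal sheaves finishes.

Conversely, suppose that infinitely many `σ⁻ⁱ(c)` lie in a proper closed set, with ideal sheaf `V`,
and let the `r`-th power of each maximal ideal be contained in `I`. For a set `E` of such exponents
take `Vʳ ∏ Aᵢ^{σⁱ}`, where `Aᵢ = I`, except that its component at `c` is deleted for `i ∈ E`. The
factor `Vʳ` pays for each deletion (`partialPow_le`), while Nakayama's lemma at `σ⁻ⁱ(c)` shows that
deletions are visible (`partialPow_ne`). The set of all exponents gives a right ideal that is not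
coherent; the sets of the first `n` exponents give the chain with non-torsion factors.

On the left, applying `σ⁻ⁿ` in degree `n` exchanges left ideals for right ideals over `σ⁻¹` and
`I^{σ⁻¹}` (`isLeftNoetherian_iff_stabilizes`). The resulting condition concerns forward orbits, and
the two half-orbits make up the full orbit. -/

namespace NaiveBlowup

variable {X : Scheme.{u}} [IsIntegral X]

/-! ### Pullback of subsheaves of the function field -/

section Twist

lemma algebraMap_stalkSpecializes {x y : X} (h : x ⤳ y) (a : X.presheaf.stalk y) :
    algebraMap (X.presheaf.stalk x) X.functionField (X.presheaf.stalkSpecializes h a) =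
      algebraMap (X.presheaf.stalk y) X.functionField a :=
  X.presheaf.stalkSpecializes_comp_apply (genericPoint_specializes x) h a

/-- Needed for points such as `σ⁻¹(σ(η))`, which equal the generic point `η` only propositionally.
-/
lemma exists_algebraMap_eq_of_eq_genericPoint {y : X} (hy : y = genericPoint X)
    (f : X.functionField) : ∃ a, algebraMap (X.presheaf.stalk y) X.functionField a = f := by
  subst hy
  refine ⟨f, ?_⟩
  change X.presheaf.stalkSpecializes _ f = f
  rw [TopCat.Presheaf.stalkSpecializes_refl]
  rfl

lemma funPullback_funPullback_symm (σ : X ≅ X) (f : X.functionField) :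
    funPullback σ (funPullback σ.symm f) = f := by
  have hy : σ.symm.hom (σ.hom (genericPoint X)) = genericPoint X := by simp
  obtain ⟨a, rfl⟩ := exists_algebraMap_eq_of_eq_genericPoint hy f
  rw [funPullback_algebraMap, funPullback_algebraMap]
  have h := Scheme.Hom.stalkMap_inv_hom_apply σ (genericPoint X) a
  exact (congrArg _ h).trans (algebraMap_stalkSpecializes (specializes_of_eq hy.symm) a)

lemma twist_twist_symm (σ : X ≅ X) (F : FracSub X) : twist σ (twist σ.symm F) = F := by
  funext x
  rw [twist_eq_span σ (twist σ.symm F) x _ rfl, ← Set.image_comp]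
  have h1 : (funPullback σ ∘ funPullback σ.symm : X.functionField → X.functionField) = id :=
    funext (funPullback_funPullback_symm σ)
  rw [h1, Set.image_id]
  have h2 (y : X) (hy : y = x) : (F y : Set X.functionField) = F x := by rw [hy]
  rw [h2 _ (by simp), Submodule.span_eq]

lemma twist_symm_twist (σ : X ≅ X) (F : FracSub X) : twist σ.symm (twist σ F) = F :=
  twist_twist_symm σ.symm F

lemma mem_iff_of_eq (F : FracSub X) {x y : X} (h : x = y) (f : X.functionField) :
    f ∈ F x ↔ f ∈ F y := by rw [h]

lemma funPullback_mem_twist (σ : X ≅ X) (F : FracSub X) (x : X) (f : X.functionField) :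
    funPullback σ f ∈ twist σ F x ↔ f ∈ F (σ.hom x) := by
  refine ⟨fun h => ?_, fun h => Submodule.subset_span ⟨f, h, rfl⟩⟩
  rw [← twist_symm_twist σ F, ← funPullback_funPullback_symm σ.symm f]
  refine Submodule.subset_span ⟨_, ?_, rfl⟩
  exact (mem_iff_of_eq _ (show σ.symm.hom (σ.hom x) = x by simp) _).2 h

lemma one_mem_twist (σ : X ≅ X) (F : FracSub X) (x : X) :
    1 ∈ twist σ F x ↔ 1 ∈ F (σ.hom x) := by
  rw [← funPullback_mem_twist, map_one]

lemma pointPerm_pow_succ {Y : Scheme.{u}} (σ : Y ≅ Y) (n : ℕ) (x : Y) :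
    (pointPerm σ ^ (n + 1)) x = (pointPerm σ ^ n) (σ.hom x) := by
  rw [pow_succ]; rfl

/-- For an ideal sheaf, `1 ∉ F x` says that `x` lies in its zero locus. Thus the zero locus of
`I^{σⁿ}` is `σ⁻ⁿ(S)`, the only information about supports used below. -/
lemma one_mem_iterate_twist (σ : X ≅ X) (F : FracSub X) (n : ℕ) (x : X) :
    1 ∈ (twist σ)^[n] F x ↔ 1 ∈ F ((pointPerm σ ^ n) x) := by
  induction n generalizing x with
  | zero => rfl
  | succ n ih => rw [Function.iterate_succ_apply', one_mem_twist, ih, pointPerm_pow_succ]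

lemma pointPerm_symm {Y : Scheme.{u}} (σ : Y ≅ Y) : pointPerm σ.symm = (pointPerm σ)⁻¹ := rfl

lemma iterate_twist_mono (σ : X ≅ X) (n : ℕ) : Monotone ((twist σ)^[n] : FracSub X → FracSub X) :=
  (twist_mono σ).iterate n

lemma iterate_twist_one (σ : X ≅ X) (n : ℕ) : (twist σ)^[n] (1 : FracSub X) = 1 :=
  Function.iterate_fixed (twist_one σ) n

lemma IsQCoh.iterate_twist {F : FracSub X} (hF : IsQCoh F) (σ : X ≅ X) (n : ℕ) :
    IsQCoh ((NaiveBlowup.twist σ)^[n] F) := by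
  induction n with
  | zero => exact hF
  | succ n ih => rw [Function.iterate_succ_apply']; exact ih.twist σ

lemma iterate_twist_symm_iterate_twist (σ : X ≅ X) (F : FracSub X) (n : ℕ) :
    (twist σ.symm)^[n] ((twist σ)^[n] F) = F :=
  Function.LeftInverse.iterate (twist_symm_twist σ) n F

lemma iterate_twist_iterate_twist_symm (σ : X ≅ X) (F : FracSub X) (n : ℕ) :
    (twist σ)^[n] ((twist σ.symm)^[n] F) = F :=
  Function.LeftInverse.iterate (twist_twist_symm σ) n F

lemma twistedPow_succ (σ : X ≅ X) (F : FracSub X) (n : ℕ) :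
    twistedPow σ F (n + 1) = twistedPow σ F n * (twist σ)^[n] F :=
  Finset.prod_range_succ _ _

lemma twistedPow_zero (σ : X ≅ X) (F : FracSub X) : twistedPow σ F 0 = 1 :=
  Finset.prod_range_zero _

lemma twistedPow_one (σ : X ≅ X) (F : FracSub X) : twistedPow σ F 1 = F := by
  rw [twistedPow_succ, twistedPow_zero, one_mul]; rfl

lemma twistedPow_mul (σ : X ≅ X) (F G : FracSub X) (n : ℕ) :
    twistedPow σ (F * G) n = twistedPow σ F n * twistedPow σ G n := by
  simp only [twistedPow, iterate_twist_mul, Finset.prod_mul_distrib]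

lemma twistedPow_le_one (σ : X ≅ X) {F : FracSub X} (hF : F ≤ 1) (n : ℕ) :
    twistedPow σ F n ≤ 1 :=
  Finset.prod_le_one' fun i _ => (iterate_twist_mono σ i hF).trans_eq (iterate_twist_one σ i)

end Twist

/-! ### Maximal ideals of the stalks and Nakayama's lemma -/

section Stalk

/-- The maximal ideal of `𝒪_{X,x}`, for each point `x`, as a family of submodules of `K`. -/
noncomputable def maxSub (X : Scheme.{u}) [IsIntegral X] : FracSub X := fun x =>
  Submodule.map (Algebra.linearMap (X.presheaf.stalk x) X.functionField)
    (IsLocalRing.maximalIdeal (X.presheaf.stalk x))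

lemma algebraMap_stalk_injective (x : X) :
    Function.Injective (algebraMap (X.presheaf.stalk x) X.functionField) :=
  IsFractionRing.injective _ _

lemma mem_one_iff {x : X} {f : X.functionField} :
    f ∈ (1 : FracSub X) x ↔ ∃ a, algebraMap (X.presheaf.stalk x) X.functionField a = f :=
  Submodule.mem_one

lemma maxSub_le_one : maxSub X ≤ 1 := by
  rintro x _ ⟨a, -, rfl⟩
  exact mem_one_iff.2 ⟨a, rfl⟩

lemma one_notMem_maxSub (x : X) : (1 : X.functionField) ∉ maxSub X x := by
  rintro ⟨a, ha, h⟩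
  rw [Algebra.linearMap_apply, ← map_one (algebraMap (X.presheaf.stalk x) _)] at h
  rw [algebraMap_stalk_injective x h] at ha
  exact (Ideal.ne_top_iff_one _).1 (IsLocalRing.maximalIdeal.isMaximal _).ne_top ha

lemma le_maxSub_of_one_notMem {F : FracSub X} {x : X} (h1 : F x ≤ (1 : FracSub X) x)
    (h : 1 ∉ F x) : F x ≤ maxSub X x := by
  intro f hf
  obtain ⟨a, rfl⟩ := mem_one_iff.1 (h1 hf)
  refine ⟨a, ?_, rfl⟩
  rw [SetLike.mem_coe, IsLocalRing.mem_maximalIdeal, mem_nonunits_iff]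
  rintro ⟨u, rfl⟩
  apply h
  have := (F x).smul_mem (↑u⁻¹ : X.presheaf.stalk x) hf
  rwa [Algebra.smul_def, ← map_mul, Units.inv_mul, map_one] at this

lemma twist_maxSub_le (σ : X ≅ X) : twist σ (maxSub X) ≤ maxSub X := fun x =>
  le_maxSub_of_one_notMem (((twist_mono σ) maxSub_le_one).trans_eq (twist_one σ) x)
    fun h => one_notMem_maxSub _ ((one_mem_twist σ _ x).1 h)

lemma twist_maxSub (σ : X ≅ X) : twist σ (maxSub X) = maxSub X :=
  (twist_maxSub_le σ).antisymm <| (twist_twist_symm σ (maxSub X)).symm.trans_le <|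
    twist_mono σ (twist_maxSub_le σ.symm)

/-- Because of this invariance, one exponent `r` with `maxSub X ^ r ≤ I` serves all twists of `I` at
once. -/
lemma iterate_twist_maxSub_pow (σ : X ≅ X) (n r : ℕ) :
    (twist σ)^[n] (maxSub X ^ r) = maxSub X ^ r := by
  refine Function.iterate_fixed ?_ n
  induction r with
  | zero => rw [pow_zero, twist_one]
  | succ r ih => rw [pow_succ, twist_mul, ih, twist_maxSub]

lemma eq_one_of_one_mem {F : FracSub X} {x : X} (h1 : F x ≤ (1 : FracSub X) x) (h : 1 ∈ F x) :
    F x = (1 : FracSub X) x :=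
  h1.antisymm (Submodule.one_le.2 h)

/-- Nakayama's lemma at a point. -/
lemma not_le_mul_maxSub {x : X} [IsNoetherianRing (X.presheaf.stalk x)]
    {M : Submodule (X.presheaf.stalk x) X.functionField} (h1 : M ≤ 1) (h0 : M ≠ ⊥) :
    ¬ M ≤ M * maxSub X x := by
  intro h
  apply h0
  refine Submodule.eq_bot_of_le_smul_of_le_jacobson_bot
    (IsLocalRing.maximalIdeal (X.presheaf.stalk x)) M ?_ ?_
    (IsLocalRing.maximalIdeal_le_jacobson _)
  · obtain ⟨J, rfl⟩ : ∃ J : Ideal (X.presheaf.stalk x),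
        Submodule.map (Algebra.linearMap (X.presheaf.stalk x) X.functionField) J = M := by
      refine ⟨Submodule.comap (Algebra.linearMap _ _) M, Submodule.map_comap_eq_of_le ?_⟩
      rwa [Submodule.one_eq_range] at h1
    exact (IsNoetherian.noetherian J).map _
  · refine h.trans (Submodule.mul_le.2 ?_)
    rintro m hm _ ⟨a, ha, rfl⟩
    rw [Algebra.linearMap_apply, mul_comm, ← Algebra.smul_def]
    exact Submodule.smul_mem_smul ha hm

end Stalk

/-! ### Quasi-coherent subsheaves on affine open sets -/

section Affine

lemma algebraMap_germ_mul_mem {F : FracSub X} {U : X.Opens} [Nonempty U] {y : X} (hy : y ∈ U)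
    (a : Γ(X, U)) {f : X.functionField} (hf : f ∈ F y) : X.germToFunctionField U a * f ∈ F y := by
  rw [← Scheme.algebraMap_germ_eq_germToFunctionField X hy, ← Algebra.smul_def]
  exact Submodule.smul_mem _ _ hf

lemma mem_of_germ_mul_mem {F : FracSub X} {U : X.Opens} [Nonempty U] {y : X} {a : Γ(X, U)}
    (hy : y ∈ X.basicOpen a) {f : X.functionField}
    (hf : X.germToFunctionField U a * f ∈ F y) : f ∈ F y := by
  have hyU : y ∈ U := X.basicOpen_le a hy
  obtain ⟨u, hu⟩ := (X.mem_basicOpen a y hyU).1 hy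
  have h := (F y).smul_mem (↑u⁻¹ : X.presheaf.stalk y) hf
  rwa [← Scheme.algebraMap_germ_eq_germToFunctionField X hyU, ← hu, Algebra.smul_def, ← mul_assoc,
    ← map_mul, Units.inv_mul, map_one, one_mul] at h

lemma exists_germ_mul_eq {U : X.Opens} (hU : IsAffineOpen U) [Nonempty U] {y : X} (hy : y ∈ U)
    (r : X.presheaf.stalk y) : ∃ s b : Γ(X, U), y ∈ X.basicOpen s ∧
      X.germToFunctionField U s * algebraMap _ X.functionField r = X.germToFunctionField U b := by
  have := hU.isLocalization_stalk ⟨y, hy⟩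
  let _ := TopCat.Presheaf.algebra_section_stalk X.presheaf (⟨y, hy⟩ : U)
  obtain ⟨⟨b, s⟩, h⟩ := IsLocalization.surj (hU.primeIdealOf ⟨y, hy⟩).asIdeal.primeCompl r
  refine ⟨s, b, (X.mem_basicOpen _ y hy).2 (IsLocalization.map_units (X.presheaf.stalk y) s), ?_⟩
  have h' := congrArg (algebraMap (X.presheaf.stalk y) X.functionField) h
  rw [map_mul, mul_comm] at h'
  rw [← Scheme.algebraMap_germ_eq_germToFunctionField X hy,
    ← Scheme.algebraMap_germ_eq_germToFunctionField X hy]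
  exact h'

lemma exists_mul_mem_span {U : X.Opens} (hU : IsAffineOpen U) [Nonempty U] {y : X} (hy : y ∈ U)
    {T : Set X.functionField} {f : X.functionField}
    (hf : f ∈ Submodule.span (X.presheaf.stalk y) T) :
    ∃ a : Γ(X, U), y ∈ X.basicOpen a ∧
      X.germToFunctionField U a * f ∈ Submodule.span Γ(X, U) T := by
  have one : y ∈ X.basicOpen (1 : Γ(X, U)) := by
    rw [X.mem_basicOpen _ y hy, map_one]; exact isUnit_one
  induction hf using Submodule.span_induction with
  | mem f hf => exact ⟨1, one, by rw [map_one, one_mul]; exact Submodule.subset_span hf⟩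
  | zero => exact ⟨1, one, by rw [mul_zero]; exact Submodule.zero_mem _⟩
  | add f g _ _ hf hg =>
    obtain ⟨a, ha, ha'⟩ := hf
    obtain ⟨b, hb, hb'⟩ := hg
    refine ⟨a * b, by rw [Scheme.basicOpen_mul]; exact ⟨ha, hb⟩, ?_⟩
    have e : X.germToFunctionField U (a * b) * (f + g) =
        b • (X.germToFunctionField U a * f) + a • (X.germToFunctionField U b * g) := by
      change _ = X.germToFunctionField U b * _ + X.germToFunctionField U a * _
      rw [map_mul]; ring
    rw [e]
    exact Submodule.add_mem _ (Submodule.smul_mem _ _ ha') (Submodule.smul_mem _ _ hb')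
  | smul r f _ hf =>
    obtain ⟨a, ha, ha'⟩ := hf
    obtain ⟨s, b, hs, hb⟩ := exists_germ_mul_eq hU hy r
    refine ⟨a * s, by rw [Scheme.basicOpen_mul]; exact ⟨ha, hs⟩, ?_⟩
    have e : X.germToFunctionField U (a * s) * r • f = b • (X.germToFunctionField U a * f) := by
      change _ = X.germToFunctionField U b * _
      rw [map_mul, Algebra.smul_def, ← hb]; ring
    rw [e]
    exact Submodule.smul_mem _ _ ha'

lemma mem_of_mem_span_sections {F : FracSub X} {U : X.Opens} [Nonempty U] {y : X} (hy : y ∈ U)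
    {T : Set X.functionField} (hT : T ⊆ F y) {f : X.functionField}
    (hf : f ∈ Submodule.span Γ(X, U) T) : f ∈ F y := by
  induction hf using Submodule.span_induction with
  | mem f hf => exact hT hf
  | zero => exact zero_mem _
  | add f g _ _ hf hg => exact add_mem hf hg
  | smul r f _ hf => exact algebraMap_germ_mul_mem hy r hf

/-- A prime containing `J` but not `h` would be a point of the basic open set of `h` at which all of
`J` vanishes; so `h` lies in the radical of `J`. -/
lemma exists_pow_mem_of_forall_mem_basicOpen {Y : Scheme.{u}} {U : Y.Opens}
    (hU : IsAffineOpen U) (J : Ideal Γ(Y, U)) (h : Γ(Y, U))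
    (H : ∀ z ∈ Y.basicOpen h, ∃ a ∈ J, z ∈ Y.basicOpen a) :
    ∃ n, h ^ n ∈ J := by
  rw [← Ideal.mem_radical_iff, Ideal.radical_eq_sInf, Ideal.mem_sInf]
  rintro P ⟨hJP, hP⟩
  by_contra hh
  have key (a : Γ(Y, U)) : hU.fromSpec ⟨P, hP⟩ ∈ Y.basicOpen a ↔ a ∉ P := by
    rw [← PrimeSpectrum.mem_basicOpen a ⟨P, hP⟩, ← hU.fromSpec_preimage_basicOpen]
    rfl
  obtain ⟨a, haJ, ha⟩ := H _ ((key h).2 hh)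
  exact (key a).1 ha (hJP haJ)

/-- Extension of a section after multiplication by a power of `h`. The ideal of all `a` with `a f`
in the `Γ(X, U)`-span of `T` has no zero where `g h` is invertible, so it contains a power of `g h`,
and `g` is a unit on its own basic open set. -/
lemma exists_pow_mul_mem {F : FracSub X} {U : X.Opens} (hU : IsAffineOpen U) [Nonempty U]
    {g h : Γ(X, U)} {T : Set X.functionField}
    (hT : ∀ z ∈ X.basicOpen g, F z = Submodule.span (X.presheaf.stalk z) T)
    {f : X.functionField} (hf : ∀ z ∈ X.basicOpen g, z ∈ X.basicOpen h → f ∈ F z) :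
    ∃ N : ℕ, ∀ z ∈ X.basicOpen g, X.germToFunctionField U (h ^ N) * f ∈ F z := by
  obtain ⟨N, hN⟩ := exists_pow_mem_of_forall_mem_basicOpen hU
    (Submodule.comap (LinearMap.toSpanSingleton Γ(X, U) X.functionField f)
      (Submodule.span Γ(X, U) T)) (g * h) fun z hz => by
    rw [Scheme.basicOpen_mul] at hz
    have h1 := hf z hz.1 hz.2
    rw [hT z hz.1] at h1
    obtain ⟨a, ha, ha'⟩ := exists_mul_mem_span hU (X.basicOpen_le g hz.1) h1
    exact ⟨a, ha', ha⟩
  refine ⟨N, fun z hz => ?_⟩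
  have hzN : z ∈ X.basicOpen (g ^ N) := by
    have hzU := X.basicOpen_le g hz
    rw [X.mem_basicOpen _ z hzU, map_pow]
    exact ((X.mem_basicOpen _ z hzU).1 hz).pow N
  refine mem_of_germ_mul_mem hzN ?_
  rw [← mul_assoc, ← map_mul, ← mul_pow]
  refine mem_of_mem_span_sections (X.basicOpen_le g hz) ?_ hN
  rw [hT z hz]
  exact Submodule.subset_span

/-- The ideal of the sections of `𝒪_X` over `U` which lie in the subsheaf `F` of `K`. -/
noncomputable def sectionsIdeal (F : FracSub X) (U : X.Opens) [Nonempty U] : Ideal Γ(X, U) where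
  carrier := {a | ∀ y ∈ U, X.germToFunctionField U a ∈ F y}
  zero_mem' y _ := by rw [map_zero]; exact zero_mem _
  add_mem' ha hb y hy := by rw [map_add]; exact add_mem (ha y hy) (hb y hy)
  smul_mem' c a ha y hy := by
    rw [smul_eq_mul, map_mul]; exact algebraMap_germ_mul_mem hy c (ha y hy)

/-- The germ `f` is a section of `F` near `y`, on the basic open set of some `h`. By compactness of
`U`, a single power of `h` makes it a section over all of `U`; a further factor `s` makes it
regular. -/
lemma IsQCoh.exists_mul_eq_section {F : FracSub X} (hF : IsQCoh F) (h1 : F ≤ 1) {U : X.Opens}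
    (hU : IsAffineOpen U) [Nonempty U] {y : X} (hy : y ∈ U) {f : X.functionField} (hf : f ∈ F y) :
    ∃ s, y ∈ X.basicOpen s ∧ ∃ b ∈ sectionsIdeal F U,
      X.germToFunctionField U s * f = X.germToFunctionField U b := by
  have loc (z : U) : ∃ (g : Γ(X, U)) (T : Set X.functionField), z.1 ∈ X.basicOpen g ∧
      ∀ w ∈ X.basicOpen g, F w = Submodule.span (X.presheaf.stalk w) T := by
    obtain ⟨V, hzV, T, hT⟩ := hF z.1
    obtain ⟨g, hgV, hzg⟩ := hU.exists_basicOpen_le (V := V) ⟨z.1, hzV⟩ z.2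
    exact ⟨g, T, hzg, fun w hw => hT w (hgV hw)⟩
  choose g T hzg hT using loc
  -- `f` is a section of `F` over the basic open set of `h`
  obtain ⟨h, hyh, hh⟩ : ∃ h : Γ(X, U), y ∈ X.basicOpen h ∧ ∀ z ∈ X.basicOpen h, f ∈ F z := by
    have hf' := hf
    rw [hT ⟨y, hy⟩ y (hzg ⟨y, hy⟩)] at hf'
    obtain ⟨a, ha, ha'⟩ := exists_mul_mem_span hU hy hf'
    refine ⟨g ⟨y, hy⟩ * a, by rw [Scheme.basicOpen_mul]; exact ⟨hzg ⟨y, hy⟩, ha⟩, fun z hz => ?_⟩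
    rw [Scheme.basicOpen_mul] at hz
    refine mem_of_germ_mul_mem hz.2 (mem_of_mem_span_sections (X.basicOpen_le a hz.2) ?_ ha')
    rw [hT ⟨y, hy⟩ z hz.1]
    exact Submodule.subset_span
  choose N hN using fun z : U => exists_pow_mul_mem hU (hT z) (f := f) (h := h)
    fun w _ hw => hh w hw
  obtain ⟨t, ht⟩ := hU.isCompact.elim_finite_subcover (fun z : U => (X.basicOpen (g z) : Set X))
    (fun z => (X.basicOpen (g z)).isOpen) fun z hz => Set.mem_iUnion.2 ⟨⟨z, hz⟩, hzg ⟨z, hz⟩⟩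
  have hall (w : X) (hw : w ∈ U) : X.germToFunctionField U (h ^ t.sup N) * f ∈ F w := by
    obtain ⟨z, hz, hwz⟩ := Set.mem_iUnion₂.1 (ht hw)
    rw [← Nat.sub_add_cancel (Finset.le_sup hz : N z ≤ t.sup N), pow_add, map_mul, mul_assoc]
    exact algebraMap_germ_mul_mem hw _ (hN z w hwz)
  obtain ⟨r, rfl⟩ := mem_one_iff.1 (h1 y hf)
  obtain ⟨s, b, hs, hsb⟩ := exists_germ_mul_eq hU hy r
  refine ⟨s * h ^ t.sup N, ?_, b * h ^ t.sup N, fun w hw => ?_, ?_⟩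
  · rw [Scheme.basicOpen_mul]
    refine ⟨hs, ?_⟩
    rw [SetLike.mem_coe, X.mem_basicOpen _ y hy, map_pow]
    exact ((X.mem_basicOpen _ y hy).1 hyh).pow _
  · have := algebraMap_germ_mul_mem hw s (hall w hw)
    rwa [mul_left_comm, hsb, ← map_mul, mul_comm] at this
  · rw [map_mul, map_mul, ← hsb]; ring

/-- A quasi-coherent ideal sheaf is generated by its sections on every affine open set. -/
lemma IsQCoh.eq_span_sectionsIdeal {F : FracSub X} (hF : IsQCoh F) (h1 : F ≤ 1) {U : X.Opens}
    (hU : IsAffineOpen U) [Nonempty U] {y : X} (hy : y ∈ U) :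
    F y = Submodule.span (X.presheaf.stalk y) (X.germToFunctionField U '' sectionsIdeal F U) := by
  apply le_antisymm
  · intro f hf
    obtain ⟨s, hs, b, hb, e⟩ := hF.exists_mul_eq_section h1 hU hy hf
    refine mem_of_germ_mul_mem (F := fun y => Submodule.span (X.presheaf.stalk y) _) hs ?_
    rw [e]
    exact Submodule.subset_span ⟨b, hb, rfl⟩
  · rw [Submodule.span_le]
    rintro _ ⟨b, hb, rfl⟩
    exact hb y hy

lemma exists_affine_mem {Y : Scheme.{u}} (x : Y) : ∃ U : Y.Opens, IsAffineOpen U ∧ x ∈ U := by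
  obtain ⟨_, ⟨U, hU, rfl⟩, hxU, -⟩ :=
    Y.isBasis_affineOpens.exists_subset_of_mem_open (Set.mem_univ x) isOpen_univ
  exact ⟨U, hU, hxU⟩

lemma IsQCoh.isOpen_one_mem {F : FracSub X} (hF : IsQCoh F) : IsOpen {x | 1 ∈ F x} := by
  rw [isOpen_iff_forall_mem_open]
  intro x hx
  obtain ⟨V, hxV, T, hT⟩ := hF x
  obtain ⟨_, ⟨U, hU, rfl⟩, hxU, hUV⟩ :=
    X.isBasis_affineOpens.exists_subset_of_mem_open hxV V.isOpen
  have : Nonempty U := ⟨⟨x, hxU⟩⟩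
  rw [Set.mem_ofPred_eq, hT x hxV] at hx
  obtain ⟨a, ha, ha'⟩ := exists_mul_mem_span hU hxU hx
  refine ⟨X.basicOpen a, fun z hz => ?_, (X.basicOpen a).isOpen, ha⟩
  have hzU := X.basicOpen_le a hz
  refine mem_of_germ_mul_mem hz (mem_of_mem_span_sections hzU ?_ ha')
  rw [hT z (hUV hzU)]
  exact Submodule.subset_span

lemma mul_mem_of_eq_genericPoint {F : FracSub X} {y : X} (hy : y = genericPoint X)
    (f : X.functionField) {g : X.functionField} (hg : g ∈ F y) : f * g ∈ F y := by
  obtain ⟨a, rfl⟩ := exists_algebraMap_eq_of_eq_genericPoint hy f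
  rw [← Algebra.smul_def]
  exact Submodule.smul_mem _ a hg

/-- A nonzero local generator near `x` also lies in the generic stalk, which is closed under
multiplication by all of `K`. -/
lemma IsQCoh.one_mem_of_eq_genericPoint {F : FracSub X} (hF : IsQCoh F) {x y : X} (hx : F x ≠ ⊥)
    (hy : y = genericPoint X) : 1 ∈ F y := by
  obtain ⟨U, hxU, T, hT⟩ := hF x
  rw [hT x hxU, Ne, Submodule.span_eq_bot] at hx
  push Not at hx
  obtain ⟨t, ht, h0⟩ := hx
  have hyU : y ∈ U := by
    rw [hy]; exact (genericPoint_specializes x).mem_open U.isOpen hxU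
  have : t ∈ F y := by rw [hT _ hyU]; exact Submodule.subset_span ht
  have := mul_mem_of_eq_genericPoint hy t⁻¹ this
  rwa [inv_mul_cancel₀ h0] at this

lemma IsQCoh.isCoh [IsLocallyNoetherian X] {F : FracSub X} (hF : IsQCoh F) (h1 : F ≤ 1) :
    IsCoh F := fun x => by
  obtain ⟨U, hU, hxU⟩ := exists_affine_mem x
  have : Nonempty U := ⟨⟨x, hxU⟩⟩
  have : IsNoetherianRing Γ(X, U) := IsLocallyNoetherian.component_noetherian ⟨U, hU⟩
  obtain ⟨t, ht⟩ := (IsNoetherian.noetherian (sectionsIdeal F U) : (sectionsIdeal F U).FG)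
  refine ⟨U, hxU, X.germToFunctionField U '' t, t.finite_toSet.image _, fun y hy => ?_⟩
  rw [hF.eq_span_sectionsIdeal h1 hU hy]
  apply le_antisymm
  · rw [Submodule.span_le]
    rintro _ ⟨b, hb, rfl⟩
    rw [← ht] at hb
    refine mem_of_mem_span_sections
      (F := fun y => Submodule.span (X.presheaf.stalk y) (X.germToFunctionField U '' t)) hy
      (T := X.germToFunctionField U '' t) Submodule.subset_span ?_
    have := Submodule.mem_map_of_mem (f := Algebra.linearMap Γ(X, U) X.functionField) hb
    rwa [Submodule.map_span] at this
  · refine Submodule.span_mono (Set.image_mono ?_)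
    rw [← ht]
    exact Submodule.subset_span

/-- The ascending chain condition for quasi-coherent ideal sheaves. -/
lemma exists_forall_eq_of_monotone [AlgebraicGeometry.IsNoetherian X] {F : ℕ → FracSub X} (hF : ∀ n, IsQCoh (F n))
    (h1 : ∀ n, F n ≤ 1) (hm : Monotone F) : ∃ d, ∀ n ≥ d, F n = F d := by
  have key (x : X) : ∃ (U : X.Opens) (d : ℕ), x ∈ U ∧ ∀ n ≥ d, ∀ y ∈ U, F n y = F d y := by
    obtain ⟨U, hU, hxU⟩ := exists_affine_mem x
    have : Nonempty U := ⟨⟨x, hxU⟩⟩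
    have : IsNoetherianRing Γ(X, U) := IsLocallyNoetherian.component_noetherian ⟨U, hU⟩
    obtain ⟨d, hd⟩ := monotone_stabilizes_iff_noetherian.2 this
      ⟨fun n => sectionsIdeal (F n) U, fun n m hnm a ha y hy => hm hnm y (ha y hy)⟩
    refine ⟨U, d, hxU, fun n hn y hy => ?_⟩
    rw [(hF n).eq_span_sectionsIdeal (h1 n) hU hy, (hF d).eq_span_sectionsIdeal (h1 d) hU hy]
    have : sectionsIdeal (F d) U = sectionsIdeal (F n) U := hd n hn
    rw [this]
  choose U d hxU hd using key
  obtain ⟨t, ht⟩ := isCompact_univ.elim_finite_subcover (fun x => (U x : Set X))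
    (fun x => (U x).isOpen) fun x _ => Set.mem_iUnion.2 ⟨x, hxU x⟩
  refine ⟨t.sup d, fun n hn => funext fun y => ?_⟩
  obtain ⟨x, hx, hy⟩ := Set.mem_iUnion₂.1 (ht (Set.mem_univ y))
  have h : d x ≤ t.sup d := Finset.le_sup hx
  rw [hd x n (h.trans hn) y hy, hd x _ h y hy]

end Affine

/-! ### Critical density forces right ideals to stabilize -/

section Stabilizes

lemma injective_zpow_apply {α : Type*} (g : Equiv.Perm α) {c : α}
    (h : ∀ n : ℕ, 0 < n → (g ^ n) c ≠ c) : Function.Injective fun i : ℤ => (g ^ i) c := by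
  have key (i j : ℤ) (hij : i < j) : (g ^ i) c ≠ (g ^ j) c := by
    intro e
    refine h (j - i).toNat (by omega) ?_
    have := congrArg (g ^ (-i)) e
    rw [← Equiv.Perm.mul_apply, ← Equiv.Perm.mul_apply, ← zpow_add, ← zpow_add, neg_add_cancel,
      zpow_zero] at this
    rw [← zpow_natCast, Int.toNat_of_nonneg (by omega), sub_eq_neg_add, ← this]
    rfl
  intro i j e
  rcases lt_trichotomy i j with hij | hij | hij
  · exact (key i j hij e).elim
  · exact hij
  · exact (key j i hij e.symm).elim

/-- Every quasi-coherent graded right ideal of `⨁ₙ E E^σ ⋯ E^{σ^{n-1}}` is generated in bounded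
degrees. -/
def Stabilizes (σ : X ≅ X) (E : FracSub X) : Prop :=
  ∀ G : ℕ → FracSub X, (∀ n, IsQCoh (G n)) → (∀ n, G n ≤ twistedPow σ E n) →
    (∀ n, G n * (twist σ)^[n] E ≤ G (n + 1)) → ∃ d, ∀ n ≥ d, G (n + 1) = G n * (twist σ)^[n] E

lemma mul_iterate_twist_twistedPow_le {σ : X ≅ X} {E : FracSub X} {G : ℕ → FracSub X}
    (hG : ∀ n, G n * (twist σ)^[n] E ≤ G (n + 1)) (n m : ℕ) :
    G n * (twist σ)^[n] (twistedPow σ E m) ≤ G (n + m) := by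
  induction m with
  | zero => rw [twistedPow_zero, iterate_twist_one, mul_one]; rfl
  | succ m ih =>
    rw [twistedPow_succ, iterate_twist_mul, ← mul_assoc, ← Function.iterate_add_apply]
    exact (mul_le_mul_left ih _).trans (hG (n + m))

lemma iterate_twist_twistedPow_succ (σ : X ≅ X) (F : FracSub X) (n m : ℕ) :
    (twist σ)^[n] (twistedPow σ F (m + 1)) =
      (twist σ)^[n] (twistedPow σ F m) * (twist σ)^[n + m] F := by
  rw [twistedPow_succ, iterate_twist_mul, ← Function.iterate_add_apply]

/-- The support of `I^{σⁿ}` meets `Y` only if `σ⁻ⁿ(c) ∈ Y` for one of the finitely many `c` in the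
support of `I`. For each `c` this happens finitely often, since otherwise an infinite, hence dense,
part of its orbit would lie in `Y`. -/
lemma exists_forall_iterate_twist_apply_eq_one {σ : X ≅ X} {I : FracSub X} (h1 : I ≤ 1)
    (hfin : {x | 1 ∉ I x}.Finite)
    (hord : ∀ p, 1 ∉ I p → ∀ n : ℕ, 0 < n → (pointPerm σ ^ n) p ≠ p)
    (hcd : ∀ c, 1 ∉ I c → CriticallyDense {x : X | ∃ i : ℕ, x = (pointPerm σ ^ (-(i : ℤ))) c})
    {Y : Set X} (hY : IsClosed Y) (hne : Y ≠ Set.univ) :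
    ∃ m, ∀ n ≥ m, ∀ y ∈ Y, (twist σ)^[n] I y = (1 : FracSub X) y := by
  have key (c : X) (hc : c ∈ {x | 1 ∉ I x}) :
      {i : ℕ | (pointPerm σ ^ (-(i : ℤ))) c ∈ Y}.Finite := by
    by_contra hinf
    refine hne (Set.univ_subset_iff.1 ?_)
    have hinj : Function.Injective fun i : ℕ => (pointPerm σ ^ (-(i : ℤ))) c := fun i j e => by
      have := injective_zpow_apply _ (hord c hc) e
      omega
    have hD := (hcd c hc).2 ((fun i : ℕ => (pointPerm σ ^ (-(i : ℤ))) c) ''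
      {i : ℕ | (pointPerm σ ^ (-(i : ℤ))) c ∈ Y}) (by rintro _ ⟨i, -, rfl⟩; exact ⟨i, rfl⟩)
      ((Set.infinite_image_iff hinj.injOn).2 hinf)
    rw [← hD]
    refine closure_minimal ?_ hY
    rintro _ ⟨i, hi, rfl⟩
    exact hi
  obtain ⟨m, hm⟩ := (hfin.biUnion key).bddAbove
  refine ⟨m + 1, fun n hn y hy => eq_one_of_one_mem
    (((iterate_twist_mono σ n) h1).trans_eq (iterate_twist_one σ n) y) ?_⟩
  rw [one_mem_iterate_twist]
  by_contra hc
  have : n ≤ m := hm (Set.mem_biUnion (x := (pointPerm σ ^ n) y) hc (by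
    change (pointPerm σ ^ (-(n : ℤ))) ((pointPerm σ ^ n) y) ∈ Y
    rwa [zpow_neg, zpow_natCast, ← Equiv.Perm.mul_apply, inv_mul_cancel]))
  omega

theorem stabilizes_of_criticallyDense [AlgebraicGeometry.IsNoetherian X] {σ : X ≅ X}
    {I : FracSub X} (hI : IsQCoh I) (h1 : I ≤ 1) (hfin : {x | 1 ∉ I x}.Finite)
    (hord : ∀ p, 1 ∉ I p → ∀ n : ℕ, 0 < n → (pointPerm σ ^ n) p ≠ p)
    (hcd : ∀ c, 1 ∉ I c → CriticallyDense {x : X | ∃ i : ℕ, x = (pointPerm σ ^ (-(i : ℤ))) c}) :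
    Stabilizes σ I := by
  intro J hJ hJI hJm
  have hJ1 (n : ℕ) : J n ≤ 1 := (hJI n).trans (twistedPow_le_one σ h1 n)
  by_cases h0 : ∀ n, J n = ⊥
  · exact ⟨0, fun n _ => by rw [h0, h0]; exact (zero_mul ((twist σ)^[n] I)).symm⟩
  push Not at h0
  obtain ⟨a, ha⟩ := h0
  obtain ⟨x₀, hx₀⟩ := Function.ne_iff.1 ha
  let Y : Set X := {x | 1 ∉ J a x}
  have hYc : IsClosed Y := ⟨by simpa [Y, Set.compl_ofPred] using (hJ a).isOpen_one_mem⟩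
  have hYne : Y ≠ Set.univ := fun h =>
    (h ▸ Set.mem_univ _ : genericPoint X ∈ Y) ((hJ a).one_mem_of_eq_genericPoint hx₀ rfl)
  obtain ⟨m, hm⟩ := exists_forall_iterate_twist_apply_eq_one h1 hfin hord hcd hYc hYne
  -- away from `Y`, the ideal `J n` is known
  have hoff (x : X) (hx : x ∉ Y) (n : ℕ) :
      J (a + n) x = (twist σ)^[a] (twistedPow σ I n) x := by
    have hx1 : J a x = (1 : FracSub X) x := eq_one_of_one_mem (hJ1 a x) (not_not.1 hx)
    apply le_antisymm
    · refine (hJI (a + n) x).trans ?_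
      rw [← twistedPow_add, Pi.mul_apply]
      refine (mul_le_mul_left (twistedPow_le_one σ h1 a x) _).trans ?_
      rw [Pi.one_apply, one_mul]
    · refine le_trans ?_ (mul_iterate_twist_twistedPow_le hJm a n x)
      rw [Pi.mul_apply, hx1, Pi.one_apply, one_mul]
  -- From degree `b` on, all further factors `I^{σⁿ}` are trivial along `Y`; `Q` below is the
  -- product of the factors with indices from `a` to `b - 1`.
  let b := a + m
  have hb {n : ℕ} (hn : b ≤ n) (y : X) (hy : y ∈ Y) : (twist σ)^[n] I y = (1 : FracSub X) y :=
    hm n (by omega) y hy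
  have hb' (n : ℕ) (y : X) (hy : y ∈ Y) :
      (twist σ)^[b] (twistedPow σ I n) y = (1 : FracSub X) y := by
    induction n with
    | zero => rw [twistedPow_zero, iterate_twist_one]
    | succ n ih =>
      rw [iterate_twist_twistedPow_succ, Pi.mul_apply, ih, hb (Nat.le_add_right b n) y hy,
        Pi.one_apply, mul_one]
  let Q := (twist σ)^[a] (twistedPow σ I m)
  have hQ : IsQCoh Q := (hI.twistedPow σ m).iterate_twist σ a
  have hQ1 : Q ≤ 1 :=
    ((iterate_twist_mono σ a) (twistedPow_le_one σ h1 m)).trans_eq (iterate_twist_one σ a)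
  have hoff' (x : X) (hx : x ∉ Y) (n : ℕ) :
      J (b + n) x = Q x * (twist σ)^[b] (twistedPow σ I n) x := by
    rw [add_assoc, hoff x hx, ← twistedPow_add, iterate_twist_mul, Pi.mul_apply,
      ← Function.iterate_add_apply]
  classical
  -- This is `J (b + n)` with the factors `I^{σ^b}, …, I^{σ^{b+n-1}}` stripped off. What remains is
  -- constant in `n` off `Y` and ascending along `Y`.
  let J' (n : ℕ) : FracSub X := fun x => if x ∈ Y then J (b + n) x else Q x
  have hJ' (n : ℕ) : IsQCoh (J' n) := by
    intro x
    by_cases hx : x ∈ Y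
    · obtain ⟨U, hxU, T, hT⟩ := hJ (b + n) x
      -- On this neighbourhood of `x` the stripped factors are trivial, so both branches of `J'`
      -- agree with `J (b + n)`; this gives quasi-coherence across `Y`.
      let V : X.Opens := ⟨_, ((hI.twistedPow σ n).iterate_twist σ b).isOpen_one_mem⟩
      refine ⟨U ⊓ V, ⟨hxU, Submodule.one_le.1 (hb' n x hx).ge⟩, T, fun y hy => ?_⟩
      rw [← hT y hy.1]
      by_cases hyY : y ∈ Y
      · exact if_pos hyY
      · have : (twist σ)^[b] (twistedPow σ I n) y = (1 : FracSub X) y := eq_one_of_one_mem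
          (((iterate_twist_mono σ b) (twistedPow_le_one σ h1 n)).trans_eq
            (iterate_twist_one σ b) y) hy.2
        rw [hoff' y hyY, this, Pi.one_apply, mul_one]
        exact if_neg hyY
    · obtain ⟨U, hxU, T, hT⟩ := hQ x
      refine ⟨U ⊓ ⟨Yᶜ, hYc.isOpen_compl⟩, ⟨hxU, hx⟩, T, fun y hy => ?_⟩
      rw [← hT y hy.1]
      exact if_neg hy.2
  have hJ'1 (n : ℕ) : J' n ≤ 1 := fun x => by
    by_cases hx : x ∈ Y
    · simpa only [J', if_pos hx] using hJ1 (b + n) x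
    · simpa only [J', if_neg hx] using hQ1 x
  have hJ'm : Monotone J' := monotone_nat_of_le_succ fun n x => by
    by_cases hx : x ∈ Y
    · simp only [J', if_pos hx]
      refine le_trans ?_ (hJm (b + n) x)
      rw [Pi.mul_apply, hb (Nat.le_add_right b n) x hx, Pi.one_apply, mul_one]
    · simp only [J', if_neg hx, le_refl]
  obtain ⟨d, hd⟩ := exists_forall_eq_of_monotone hJ' hJ'1 hJ'm
  refine ⟨b + d, fun n hn => funext fun x => ?_⟩
  obtain ⟨e, rfl⟩ : ∃ e, n = b + (d + e) := ⟨n - b - d, by omega⟩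
  by_cases hx : x ∈ Y
  · have h2 := congrFun ((hd (d + e + 1) (by omega)).trans (hd (d + e) (by omega)).symm) x
    simp only [J', if_pos hx] at h2
    rw [add_assoc, h2, Pi.mul_apply, hb (Nat.le_add_right _ _) x hx,
      Pi.one_apply, mul_one]
  · rw [add_assoc, hoff' x hx, iterate_twist_twistedPow_succ,
      Pi.mul_apply, Pi.mul_apply, hoff' x hx, mul_assoc]

end Stabilizes

/-! ### Right ideals attached to an orbit that is not critically dense -/

section Chain

/-- Consequently, deleting the component of `I` at `c` changes `I^{σⁱ}` only at `σ⁻ⁱ(c)`. -/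
lemma iterate_twist_apply_congr (σ : X ≅ X) {F G : FracSub X} {n : ℕ} {x : X}
    (h : F ((pointPerm σ ^ n) x) = G ((pointPerm σ ^ n) x)) :
    (twist σ)^[n] F x = (twist σ)^[n] G x := by
  induction n generalizing x with
  | zero => exact h
  | succ n ih =>
    rw [pointPerm_pow_succ] at h
    rw [Function.iterate_succ_apply', Function.iterate_succ_apply']
    simp only [twist, ih h]

lemma isQCoh_prod {ι : Type*} (s : Finset ι) {F : ι → FracSub X} (hF : ∀ i, IsQCoh (F i)) :
    IsQCoh (∏ i ∈ s, F i) :=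
  Finset.prod_induction _ IsQCoh (fun _ _ h h' => h.mul h') isQCoh_one fun i _ => hF i

lemma IsQCoh.pow {F : FracSub X} (hF : IsQCoh F) (n : ℕ) : IsQCoh (F ^ n) := by
  simpa using isQCoh_prod (Finset.range n) fun _ => hF

lemma IsQCoh.ne_bot {F : FracSub X} (hF : IsQCoh F) {y : X} (hy : y = genericPoint X)
    (h : 1 ∈ F y) (x : X) : F x ≠ ⊥ := by
  obtain ⟨U, hxU, T, hT⟩ := hF x
  intro h0
  have hyU : y ∈ U := by
    rw [hy]; exact (genericPoint_specializes x).mem_open U.isOpen hxU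
  rw [hT x hxU, Submodule.span_eq_bot] at h0
  rw [hT _ hyU, Submodule.span_eq_bot.2 h0] at h
  exact one_ne_zero ((Submodule.mem_bot _).1 h)

lemma mul_apply_ne_bot {F G : FracSub X} {x : X} (hF : F x ≠ ⊥) (hG : G x ≠ ⊥) :
    (F * G) x ≠ ⊥ := fun h => (Submodule.mul_eq_bot.1 h).elim hF hG

lemma one_apply_ne_bot (x : X) : (1 : FracSub X) x ≠ ⊥ :=
  Submodule.ne_bot_iff _ |>.2 ⟨1, Submodule.one_le.1 le_rfl, one_ne_zero⟩

lemma iterate_twist_apply_ne_bot (σ : X ≅ X) {F : FracSub X} (hF : ∀ x, F x ≠ ⊥) (n : ℕ) (x : X) :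
    (twist σ)^[n] F x ≠ ⊥ := by
  induction n generalizing x with
  | zero => exact hF x
  | succ n ih =>
    obtain ⟨f, hf, hf0⟩ := Submodule.exists_mem_ne_zero_of_ne_bot (ih (σ.hom x))
    rw [Function.iterate_succ_apply']
    exact Submodule.ne_bot_iff _ |>.2 ⟨funPullback σ f, (funPullback_mem_twist σ _ x f).2 hf,
      (map_ne_zero _).2 hf0⟩

lemma pow_apply_ne_bot {F : FracSub X} {x : X} (hF : F x ≠ ⊥) (n : ℕ) : (F ^ n) x ≠ ⊥ := by
  induction n with
  | zero => rw [pow_zero]; exact one_apply_ne_bot x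
  | succ n ih => rw [pow_succ]; exact mul_apply_ne_bot ih hF

open Classical in
/-- The subsheaf `F` with its stalk at `c` replaced by `𝒪_{X,c}`. -/
noncomputable def unitAt (F : FracSub X) (c : X) : FracSub X := fun x => if x = c then 1 else F x

lemma unitAt_self (F : FracSub X) (c : X) : unitAt F c c = 1 := if_pos rfl

lemma unitAt_of_ne (F : FracSub X) {c x : X} (h : x ≠ c) : unitAt F c x = F x := if_neg h

lemma le_unitAt {F : FracSub X} (h1 : F ≤ 1) (c : X) : F ≤ unitAt F c := fun x => by
  by_cases h : x = c
  · subst h; rw [unitAt_self]; exact h1 x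
  · rw [unitAt_of_ne F h]

lemma unitAt_le_one {F : FracSub X} (h1 : F ≤ 1) (c : X) : unitAt F c ≤ 1 := fun x => by
  by_cases h : x = c
  · subst h; rw [unitAt_self]; rfl
  · rw [unitAt_of_ne F h]; exact h1 x

/-- Near `c` one removes the other support points, a finite closed set, and the sheaf becomes `𝒪`;
away from the closed point `c` nothing has changed. -/
lemma IsQCoh.unitAt {F : FracSub X} (hF : IsQCoh F) (h1 : F ≤ 1)
    (hfin : {x | 1 ∉ F x}.Finite) (hcl : ∀ x, 1 ∉ F x → IsClosed {x}) {c : X} (hc : 1 ∉ F c) :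
    IsQCoh (unitAt F c) := fun x => by
  by_cases h : x = c
  · have hcl' : IsClosed ({x | 1 ∉ F x} \ {c}) := by
      rw [← Set.biUnion_of_singleton ({x | 1 ∉ F x} \ {c})]
      exact hfin.sdiff.isClosed_biUnion fun y hy => hcl y hy.1
    refine ⟨⟨_, hcl'.isOpen_compl⟩, fun hx => hx.2 h, {1}, fun y hy => ?_⟩
    rw [← Submodule.one_eq_span]
    by_cases hyc : y = c
    · subst hyc; exact unitAt_self F y
    · rw [unitAt_of_ne F hyc]
      exact eq_one_of_one_mem (h1 y) (by_contra fun hy' => hy ⟨hy', hyc⟩)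
  · obtain ⟨U, hxU, T, hT⟩ := hF x
    exact ⟨U ⊓ ⟨_, (hcl c hc).isOpen_compl⟩, ⟨hxU, h⟩, T, fun y hy => by
      rw [unitAt_of_ne F hy.2, hT y hy.1]⟩

open Classical in
/-- The graded right ideal `N ∏ᵢ Aᵢ^{σⁱ}` of `⨁ₙ I I^σ ⋯ I^{σ^{n-1}}`, where `Aᵢ` is the ideal
sheaf `I`, with the component at `c` removed if `i ∈ E`. -/
noncomputable def partialPow (σ : X ≅ X) (I N : FracSub X) (c : X) (E : Set ℕ) (j : ℕ) :
    FracSub X :=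
  N * ∏ i ∈ Finset.range j, (twist σ)^[i] (if i ∈ E then unitAt I c else I)

variable {σ : X ≅ X} {I N : FracSub X} {c : X}

lemma partialPow_succ_of_notMem {E : Set ℕ} {j : ℕ} (h : j ∉ E) :
    partialPow σ I N c E (j + 1) = partialPow σ I N c E j * (twist σ)^[j] I := by
  rw [partialPow, Finset.prod_range_succ, if_neg h, ← mul_assoc, partialPow]

lemma partialPow_mul_le (h1 : I ≤ 1) (E : Set ℕ) (j : ℕ) :
    partialPow σ I N c E j * (twist σ)^[j] I ≤ partialPow σ I N c E (j + 1) := by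
  rw [partialPow, partialPow, Finset.prod_range_succ, ← mul_assoc]
  refine mul_le_mul_right (iterate_twist_mono σ j ?_) _
  split_ifs
  exacts [le_unitAt h1 c, le_rfl]

lemma partialPow_mono (h1 : I ≤ 1) {E E' : Set ℕ} (h : E ⊆ E') (j : ℕ) :
    partialPow σ I N c E j ≤ partialPow σ I N c E' j := by
  refine mul_le_mul_right (Finset.prod_le_prod' fun i _ => iterate_twist_mono σ i ?_) _
  split_ifs with hi hi'
  exacts [le_rfl, (hi' (h hi)).elim, le_unitAt h1 c, le_rfl]

lemma isQCoh_partialPow (hN : IsQCoh N) (hI : IsQCoh I) (hI' : IsQCoh (unitAt I c)) (E : Set ℕ)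
    (j : ℕ) : IsQCoh (partialPow σ I N c E j) := by
  refine hN.mul (isQCoh_prod _ fun i => IsQCoh.iterate_twist ?_ σ i)
  split_ifs
  exacts [hI', hI]

/-- Since `c` has infinite order, at most one factor is altered at any given `x`, and there `N ≤ 𝔪ʳ
≤ I^{σⁱ}` replaces the deleted factor. So a fixed `N` compensates for arbitrarily many deletions. -/
lemma partialPow_le (hord : ∀ n : ℕ, 0 < n → (pointPerm σ ^ n) c ≠ c) (h1 : I ≤ 1) (hN1 : N ≤ 1)
    {r : ℕ} (hr : maxSub X ^ r ≤ I) {E : Set ℕ}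
    (hN : ∀ x, ∀ i ∈ E, (pointPerm σ ^ i) x = c → N x ≤ (maxSub X ^ r) x) (j : ℕ) :
    partialPow σ I N c E j ≤ twistedPow σ I j := by
  intro x
  rw [partialPow, twistedPow, Pi.mul_apply, Finset.prod_apply, Finset.prod_apply]
  by_cases h : ∃ i ∈ Finset.range j, i ∈ E ∧ (pointPerm σ ^ i) x = c
  · obtain ⟨i, hi, hiE, hic⟩ := h
    rw [← Finset.mul_prod_erase _ _ hi, ← Finset.mul_prod_erase _ _ hi]
    refine mul_le_mul' ?_ ?_
    · refine (hN x i hiE hic).trans ?_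
      rw [← iterate_twist_maxSub_pow σ i r]
      exact iterate_twist_mono σ i hr x
    · rw [if_pos hiE]
      refine (mul_le_mul_left ((iterate_twist_mono σ i (unitAt_le_one h1 c)).trans_eq
        (iterate_twist_one σ i) x) _).trans ?_
      rw [Pi.one_apply, one_mul]
      refine (Finset.prod_congr rfl fun i' hi' => ?_).le
      refine iterate_twist_apply_congr σ ?_
      split_ifs
      · refine unitAt_of_ne I fun hc => Finset.ne_of_mem_erase hi' ?_
        rw [← hc] at hic
        have hx : x = (pointPerm σ ^ (-(i' : ℤ))) c := by
          rw [← hc, zpow_neg, zpow_natCast, ← Equiv.Perm.mul_apply, inv_mul_cancel]; rfl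
        have := injective_zpow_apply _ hord (a₁ := i - i') (a₂ := 0) (by
          change (pointPerm σ ^ ((i : ℤ) - i')) c = c
          rw [sub_eq_add_neg, zpow_add, Equiv.Perm.mul_apply, ← hx, zpow_natCast, hic, hc])
        omega
      · rfl
  · push Not at h
    refine (mul_le_mul_left (hN1 x) _).trans ?_
    rw [Pi.one_apply, one_mul]
    refine (Finset.prod_congr rfl fun i hi => ?_).le
    refine iterate_twist_apply_congr σ ?_
    split_ifs with hiE
    · exact unitAt_of_ne I (h i hi hiE)
    · rfl

/-- At `p = σ⁻ⁱ(c)` the `i`-th factor is the unit ideal for `E'` but lies in the maximal ideal for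
`E`. With `Q` the product of `N` and the other factors, equality would give `Q E ≤ Q E' ≤ Q E · 𝔪`
at `p`, against Nakayama's lemma. -/
lemma partialPow_ne [IsLocallyNoetherian X] (h1 : I ≤ 1) (hI0 : ∀ x, I x ≠ ⊥) (hc : 1 ∉ I c)
    (hN1 : N ≤ 1) (hN0 : ∀ x, N x ≠ ⊥) {E E' : Set ℕ} (h : E ⊆ E') {i : ℕ} (hi : i ∉ E)
    (hi' : i ∈ E') {j : ℕ} (hij : i < j) :
    partialPow σ I N c E j ≠ partialPow σ I N c E' j := by
  classical
  intro e
  obtain ⟨p, hp⟩ := (pointPerm σ ^ i).surjective c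
  let A (E : Set ℕ) (i : ℕ) : FracSub X := (twist σ)^[i] (if i ∈ E then unitAt I c else I)
  let Q (E : Set ℕ) : FracSub X := N * ∏ i ∈ (Finset.range j).erase i, A E i
  have hA1 (E : Set ℕ) (i : ℕ) : A E i ≤ 1 := by
    refine (iterate_twist_mono σ i ?_).trans_eq (iterate_twist_one σ i)
    split_ifs
    exacts [unitAt_le_one h1 c, h1]
  have hQ (E : Set ℕ) : partialPow σ I N c E j = Q E * A E i := by
    rw [partialPow, ← Finset.prod_erase_mul _ _ (Finset.mem_range.2 hij), ← mul_assoc]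
  have hQ0 : Q E p ≠ ⊥ := by
    refine mul_apply_ne_bot (hN0 p) (Finset.prod_induction _ (fun F : FracSub X => F p ≠ ⊥)
      (fun _ _ h h' => mul_apply_ne_bot h h') (one_apply_ne_bot p) fun i _ => ?_)
    refine iterate_twist_apply_ne_bot σ (fun x => ?_) i p
    split_ifs
    exacts [ne_bot_of_le_ne_bot (hI0 x) (le_unitAt h1 c x), hI0 x]
  have hQ1 : Q E ≤ 1 := mul_le_one' hN1 (Finset.prod_le_one' fun i _ => hA1 E i)
  refine not_le_mul_maxSub (hQ1 p) hQ0 ?_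
  have hle : Q E ≤ Q E' := by
    refine mul_le_mul_right (Finset.prod_le_prod' fun i _ => iterate_twist_mono σ i ?_) _
    split_ifs with hi hi'
    exacts [le_rfl, (hi' (h hi)).elim, le_unitAt h1 c, le_rfl]
  have hp' : A E' i p = (1 : FracSub X) p := eq_one_of_one_mem (hA1 E' i p) (by
    simp only [A, if_pos hi']
    rw [one_mem_iterate_twist, hp, unitAt_self]
    exact Submodule.one_le.1 le_rfl)
  have hpE : A E i p ≤ maxSub X p := le_maxSub_of_one_notMem (hA1 E i p) (by
    simp only [A, if_neg hi]
    rw [one_mem_iterate_twist, hp]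
    exact hc)
  rw [hQ, hQ] at e
  calc Q E p ≤ Q E' p := hle p
    _ = (Q E' * A E' i) p := by rw [Pi.mul_apply, hp', Pi.one_apply, mul_one]
    _ = (Q E * A E i) p := by rw [e]
    _ ≤ Q E p * maxSub X p := mul_le_mul_right hpE _

/-- The ideal sheaf `I` of a zero-dimensional subscheme, a point `c` of infinite order in its support
and an ideal sheaf which vanishes at `σ⁻ⁱ(c)` for infinitely many `i`. -/
structure SparseOrbit (σ : X ≅ X) (I : FracSub X) where
  isQCoh : IsQCoh I
  le_one : I ≤ 1
  ne_bot (x : X) : I x ≠ ⊥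
  c : X
  isQCoh_unitAt : IsQCoh (unitAt I c)
  one_notMem : 1 ∉ I c
  pow_ne (n : ℕ) : 0 < n → (pointPerm σ ^ n) c ≠ c
  r : ℕ
  maxSub_pow_le : maxSub X ^ r ≤ I
  V : FracSub X
  isQCoh_V : IsQCoh V
  V_le_one : V ≤ 1
  V_ne_bot (x : X) : V x ≠ ⊥
  infinite : {i : ℕ | 1 ∉ V ((pointPerm σ ^ (-(i : ℤ))) c)}.Infinite

namespace SparseOrbit

variable (O : SparseOrbit σ I)

/-- The exponents `i` such that the ideal sheaf `V` vanishes at `σ⁻ⁱ(c)`. -/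
def exponents : Set ℕ := {i : ℕ | 1 ∉ O.V ((pointPerm σ ^ (-(i : ℤ))) O.c)}

/-- The right ideals given by the sets `E` of exponents. -/
noncomputable def ideal (E : Set ℕ) (j : ℕ) : FracSub X := partialPow σ I (O.V ^ O.r) O.c E j

lemma isQCoh_ideal (E : Set ℕ) (j : ℕ) : IsQCoh (O.ideal E j) :=
  isQCoh_partialPow (O.isQCoh_V.pow _) O.isQCoh O.isQCoh_unitAt E j

lemma ideal_le {E : Set ℕ} (hE : E ⊆ O.exponents) (j : ℕ) : O.ideal E j ≤ twistedPow σ I j := by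
  refine partialPow_le O.pow_ne O.le_one (pow_le_one' O.V_le_one _) O.maxSub_pow_le
    (fun x i hi hx => ?_) j
  have hV : O.V x ≤ maxSub X x := le_maxSub_of_one_notMem (O.V_le_one x) (by
    have := hE hi
    rwa [exponents, Set.mem_ofPred_eq, ← hx, zpow_neg, zpow_natCast, ← Equiv.Perm.mul_apply,
      inv_mul_cancel] at this)
  rw [Pi.pow_apply, Pi.pow_apply]
  exact pow_le_pow_left' hV _

lemma ideal_ne [IsLocallyNoetherian X] {E E' : Set ℕ} (h : E ⊆ E') {i : ℕ} (hi : i ∉ E)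
    (hi' : i ∈ E') {j : ℕ} (hij : i < j) : O.ideal E j ≠ O.ideal E' j :=
  partialPow_ne O.le_one O.ne_bot O.one_notMem (pow_le_one' O.V_le_one _)
    (fun x => pow_apply_ne_bot (O.V_ne_bot x) _) h hi hi' hij

/-- With all exponents in play, every exponent `j` forces new generators in degree `j + 1`:
otherwise this component would not see the deletion at `j`, and would agree with that of the set
without `j`. -/
lemma not_stabilizes (O : SparseOrbit σ I) [IsLocallyNoetherian X] : ¬ Stabilizes σ I := by
  intro h
  obtain ⟨d, hd⟩ := h (O.ideal O.exponents) (O.isQCoh_ideal _) (O.ideal_le subset_rfl)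
    (partialPow_mul_le O.le_one _)
  obtain ⟨j, hj, hdj⟩ := O.infinite.exists_gt d
  refine O.ideal_ne (E := O.exponents \ {j}) Set.sdiff_subset (fun h => h.2 rfl) hj
    (Nat.lt_succ_self j) ?_
  have e : O.ideal (O.exponents \ {j}) j = O.ideal O.exponents j := by
    rw [ideal, ideal, partialPow, partialPow]
    refine congrArg (O.V ^ O.r * ·) (Finset.prod_congr rfl fun i hi => ?_)
    have : i ≠ j := (Finset.mem_range.1 hi).ne
    have h : i ∈ O.exponents \ {j} ↔ i ∈ O.exponents := ⟨And.left, fun h => ⟨h, this⟩⟩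
    refine congrArg (twist σ)^[i] ?_
    by_cases hE : i ∈ O.exponents
    · rw [if_pos hE, if_pos (h.2 hE)]
    · rw [if_neg hE, if_neg fun h' => hE (h.1 h')]
  rw [hd j hdj.le, ← e, ideal, ideal, partialPow_succ_of_notMem fun h => h.2 rfl]

lemma exists_chain (O : SparseOrbit σ I) [IsLocallyNoetherian X] :
     ∃ G : ℕ → ℕ → FracSub X,
    (∀ n j, IsQCoh (G n j)) ∧ (∀ n j, G n j ≤ twistedPow σ I j) ∧
    (∀ n j, G n j * (twist σ)^[j] I ≤ G n (j + 1)) ∧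
    (∀ n, ∃ d, ∀ j ≥ d, G n (j + 1) = G n j * (twist σ)^[j] I) ∧
    (∀ n j, G n j ≤ G (n + 1) j) ∧ ∀ n, {j | G (n + 1) j ≠ G n j}.Infinite := by
  have hinf : ({i | i ∈ O.exponents}).Infinite := O.infinite
  -- The first `n` exponents. Finiteness makes each ideal stabilize, and the one exponent added at
  -- stage `n + 1` is visible in every higher degree.
  let E (n : ℕ) : Set ℕ := {i | i ∈ O.exponents ∧ i < Nat.nth (· ∈ O.exponents) n}
  have hE (n : ℕ) : E n ⊆ E (n + 1) := fun i hi =>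
    ⟨hi.1, hi.2.trans (Nat.nth_strictMono hinf (Nat.lt_succ_self n))⟩
  refine ⟨fun n => O.ideal (E n), fun n => O.isQCoh_ideal _, fun n => O.ideal_le fun i hi => hi.1,
    fun n => partialPow_mul_le O.le_one _, fun n => ⟨Nat.nth (· ∈ O.exponents) n, fun j hj =>
      partialPow_succ_of_notMem fun h => (h.2.trans_le hj).false⟩,
    fun n => partialPow_mono O.le_one (hE n), fun n => ?_⟩
  refine (Set.Ioi_infinite (Nat.nth (· ∈ O.exponents) n)).mono fun j hj =>
    (O.ideal_ne (hE n) (fun h => h.2.false) ?_ hj).symm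
  exact ⟨Nat.nth_mem_of_infinite hinf n, Nat.nth_strictMono hinf (Nat.lt_succ_self n)⟩

end SparseOrbit

end Chain

/-! ### Coherence of one-sided ideals in terms of stabilization -/

section Noetherian

variable {σ : X ≅ X} {E : FracSub X}

/-- Multiplication by `M M^σ ⋯ M^{σ^{n-1}}` in degree `n` turns right ideals for `E L` into right
ideals for `E`, and multiplication by the corresponding product of `L` undoes it. -/
lemma Stabilizes.mul {L M : FracSub X} (h : Stabilizes σ E) (hM : IsQCoh M) (hLM : L * M = 1) :
    Stabilizes σ (E * L) := by
  intro G hG hGE hGm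
  have hn (n : ℕ) : (twist σ)^[n] L * (twist σ)^[n] M = 1 := by
    rw [← iterate_twist_mul, hLM, iterate_twist_one]
  have hpow (n : ℕ) : twistedPow σ L n * twistedPow σ M n = 1 := by
    rw [← twistedPow_mul, hLM, twistedPow]
    exact Finset.prod_eq_one fun i _ => iterate_twist_one σ i
  have hle (n : ℕ) : G n * twistedPow σ M n ≤ twistedPow σ E n := by
    refine (mul_le_mul_left (hGE n) _).trans_eq ?_
    rw [twistedPow_mul, mul_assoc, hpow, mul_one]
  have hmul (n : ℕ) : G n * twistedPow σ M n * (twist σ)^[n] E ≤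
      G (n + 1) * twistedPow σ M (n + 1) := by
    calc G n * twistedPow σ M n * (twist σ)^[n] E
        = G n * twistedPow σ M n * (twist σ)^[n] E * ((twist σ)^[n] L * (twist σ)^[n] M) := by
          rw [hn, mul_one]
      _ = G n * (twist σ)^[n] (E * L) * twistedPow σ M (n + 1) := by
          rw [iterate_twist_mul, twistedPow_succ]; ring
      _ ≤ G (n + 1) * twistedPow σ M (n + 1) := mul_le_mul_left (hGm n) _
  obtain ⟨d, hd⟩ := h (fun n => G n * twistedPow σ M n)
    (fun n => (hG n).mul (hM.twistedPow σ n)) hle hmul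
  refine ⟨d, fun n hdn => ?_⟩
  have := congrArg (· * (twistedPow σ L n * (twist σ)^[n] L)) (hd n hdn)
  simp only [twistedPow_succ] at this
  calc G (n + 1) = G (n + 1) * (twistedPow σ L n * twistedPow σ M n) *
        ((twist σ)^[n] L * (twist σ)^[n] M) := by rw [hn, hpow, mul_one, mul_one]
    _ = G (n + 1) * (twistedPow σ M n * (twist σ)^[n] M) *
        (twistedPow σ L n * (twist σ)^[n] L) := by ring
    _ = G n * twistedPow σ M n * (twist σ)^[n] E *
        (twistedPow σ L n * (twist σ)^[n] L) := this
    _ = G n * (twist σ)^[n] (E * L) * (twistedPow σ L n * twistedPow σ M n) := by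
        rw [iterate_twist_mul]; ring
    _ = G n * (twist σ)^[n] (E * L) := by rw [hpow, mul_one]

lemma stabilizes_mul_iff {L M : FracSub X} (hL : IsQCoh L) (hM : IsQCoh M) (hLM : L * M = 1) :
    Stabilizes σ (E * L) ↔ Stabilizes σ E := by
  refine ⟨fun h => ?_, fun h => h.mul hM hLM⟩
  have := h.mul (L := M) hL (by rw [mul_comm, hLM])
  rwa [mul_assoc, hLM, mul_one] at this

variable {B : BimoduleAlgebra σ}

lemma part_succ (hB : ∀ n, B.part n = twistedPow σ E n) (n : ℕ) :
    B.part (n + 1) = B.part n * (twist σ)^[n] E := by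
  rw [hB, hB, twistedPow_succ]

lemma part_succ' (hB : ∀ n, B.part n = twistedPow σ E n) (n : ℕ) :
    B.part (n + 1) = E * twist σ (B.part n) := by
  rw [hB, hB, add_comm, ← twistedPow_add, twistedPow_one, Function.iterate_one]

lemma RightIdeal.mul_le (hB : ∀ n, B.part n = twistedPow σ E n) (P : RightIdeal B) (n : ℕ) :
    P.part n * (twist σ)^[n] E ≤ P.part (n + 1) := by
  have := P.part_mul_le n 1
  rwa [hB, twistedPow_one] at this

lemma LeftIdeal.mul_le (hB : ∀ n, B.part n = twistedPow σ E n) (P : LeftIdeal B) (n : ℕ) :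
    E * twist σ (P.part n) ≤ P.part (n + 1) := by
  have := P.mul_part_le n 1
  rwa [hB, twistedPow_one, add_comm] at this

/-- The right ideal of `B` with given components. -/
def RightIdeal.mk' (hB : ∀ n, B.part n = twistedPow σ E n) (G : ℕ → FracSub X)
    (hG : ∀ n, IsQCoh (G n)) (hGE : ∀ n, G n ≤ twistedPow σ E n)
    (hGm : ∀ n, G n * (twist σ)^[n] E ≤ G (n + 1)) : RightIdeal B where
  part := G
  isQCoh_part := hG
  part_le n := (hGE n).trans_eq (hB n).symm
  part_mul_le n m := by
    rw [hB]
    exact mul_iterate_twist_twistedPow_le hGm n m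

/-- The left ideal of `B` with given components. -/
def LeftIdeal.mk' (hB : ∀ n, B.part n = twistedPow σ E n) (G : ℕ → FracSub X)
    (hG : ∀ n, IsQCoh (G n)) (hGE : ∀ n, G n ≤ twistedPow σ E n)
    (hGm : ∀ n, E * twist σ (G n) ≤ G (n + 1)) : LeftIdeal B where
  part := G
  isQCoh_part := hG
  part_le n := (hGE n).trans_eq (hB n).symm
  mul_part_le n m := by
    induction m with
    | zero => rw [B.part_zero, one_mul, zero_add]; rfl
    | succ m ih =>
      rw [part_succ' hB, Function.iterate_succ_apply', mul_assoc, ← twist_mul, add_right_comm]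
      exact (mul_le_mul_right (twist_mono σ ih) _).trans (hGm (m + n))

/-- Generators in degrees at most `d` produce everything above by repeated multiplication by `E`.
Conversely, `P₀, …, P_d` themselves serve as generators, being coherent by `hcoh`. -/
lemma RightIdeal.isCoherent_iff (hB : ∀ n, B.part n = twistedPow σ E n)
    (hcoh : ∀ n F, IsQCoh F → F ≤ B.part n → IsCoh F) (P : RightIdeal B) :
    P.IsCoherent ↔ ∃ d, ∀ n ≥ d, P.part (n + 1) = P.part n * (twist σ)^[n] E := by
  constructor
  · rintro ⟨d, C, hC, hP⟩
    refine ⟨d, fun n hn => (P.mul_le hB n).antisymm' ?_⟩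
    rw [hP (n + 1)]
    refine sup_le bot_le (iSup_le fun i => iSup_le fun j => iSup_le fun hij => ?_)
    -- From `i ≤ d ≤ n` and `i + j = n + 1` it follows that `j ≥ 1`, so one factor `E` can be split
    -- off.
    obtain ⟨j, rfl⟩ : ∃ j', j = j' + 1 := ⟨j - 1, by omega⟩
    obtain rfl : n = i + j := by omega
    rw [part_succ hB, iterate_twist_mul, ← mul_assoc, ← Function.iterate_add_apply]
    exact mul_le_mul_left ((mul_le_mul_left (hC i).2 _).trans (P.part_mul_le i j)) _
  · rintro ⟨d, hd⟩
    refine ⟨d, P.part, fun i => ⟨hcoh i _ (P.isQCoh_part i) (P.part_le i), le_rfl⟩, fun n => ?_⟩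
    apply le_antisymm
    · refine le_trans ?_ le_sup_right
      rcases le_total n d with h | h
      · refine le_trans ?_ (le_iSup_of_le n (le_iSup_of_le 0 (le_iSup_of_le ⟨h, add_zero n⟩ le_rfl)))
        rw [B.part_zero, iterate_twist_one, mul_one]
      · obtain ⟨m, rfl⟩ := Nat.exists_eq_add_of_le h
        refine le_trans ?_ (le_iSup_of_le d (le_iSup_of_le m (le_iSup_of_le ⟨le_rfl, rfl⟩ le_rfl)))
        clear h
        induction m with
        | zero => rw [B.part_zero, iterate_twist_one, mul_one]; rfl
        | succ m ih =>
          rw [← add_assoc, hd _ (Nat.le_add_right d m), part_succ hB, iterate_twist_mul,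
            ← mul_assoc, ← Function.iterate_add_apply]
          exact mul_le_mul_left ih _
    · refine sup_le bot_le (iSup_le fun i => iSup_le fun j => iSup_le fun hij => ?_)
      rw [← hij.2]
      exact P.part_mul_le i j

lemma LeftIdeal.isCoherent_iff (hB : ∀ n, B.part n = twistedPow σ E n)
    (hcoh : ∀ n F, IsQCoh F → F ≤ B.part n → IsCoh F) (P : LeftIdeal B) :
    P.IsCoherent ↔ ∃ d, ∀ n ≥ d, P.part (n + 1) = E * twist σ (P.part n) := by
  constructor
  · rintro ⟨d, C, hC, hP⟩
    refine ⟨d, fun n hn => (P.mul_le hB n).antisymm' ?_⟩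
    rw [hP (n + 1)]
    refine iSup_le fun i => iSup_le fun j => iSup_le fun hij => ?_
    obtain ⟨j, rfl⟩ : ∃ j', j = j' + 1 := ⟨j - 1, by omega⟩
    obtain rfl : n = j + i := by omega
    rw [part_succ' hB, Function.iterate_succ_apply', mul_assoc, ← twist_mul]
    refine mul_le_mul_right (twist_mono σ ?_) _
    exact (mul_le_mul_right (iterate_twist_mono σ j (hC i).2) _).trans (P.mul_part_le i j)
  · rintro ⟨d, hd⟩
    refine ⟨d, P.part, fun i => ⟨hcoh i _ (P.isQCoh_part i) (P.part_le i), le_rfl⟩, fun n => ?_⟩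
    apply le_antisymm
    · rcases le_total n d with h | h
      · refine le_trans ?_ (le_iSup_of_le n (le_iSup_of_le 0 (le_iSup_of_le ⟨h, zero_add n⟩ le_rfl)))
        rw [B.part_zero, one_mul]; rfl
      · obtain ⟨m, rfl⟩ := Nat.exists_eq_add_of_le' h
        refine le_trans ?_ (le_iSup_of_le d (le_iSup_of_le m (le_iSup_of_le ⟨le_rfl, rfl⟩ le_rfl)))
        clear h
        induction m with
        | zero => rw [B.part_zero, one_mul, zero_add]; rfl
        | succ m ih =>
          rw [add_right_comm, hd _ (Nat.le_add_left d m), part_succ' hB,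
            Function.iterate_succ_apply', mul_assoc, ← twist_mul]
          exact mul_le_mul_right (twist_mono σ ih) _
    · refine iSup_le fun i => iSup_le fun j => iSup_le fun hij => ?_
      rw [← hij.2]
      exact P.mul_part_le i j

lemma isRightNoetherian_iff_stabilizes (hB : ∀ n, B.part n = twistedPow σ E n)
    (hcoh : ∀ n F, IsQCoh F → F ≤ B.part n → IsCoh F) :
    IsRightNoetherian B ↔ Stabilizes σ E := by
  refine ⟨fun h G hG hGE hGm => ?_, fun h P => ?_⟩
  · exact (RightIdeal.isCoherent_iff hB hcoh _).1 (h (RightIdeal.mk' hB G hG hGE hGm))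
  · exact (RightIdeal.isCoherent_iff hB hcoh P).2 (h P.part P.isQCoh_part
      (fun n => (P.part_le n).trans_eq (hB n)) (P.mul_le hB))

/-- Products in `K` commute, so untwisting degree `n + 1` by `σ^{-(n+1)}` converts left
multiplication by `E` over `σ` into right multiplication by `E^{σ⁻¹}` over `σ⁻¹`. -/
lemma iterate_twist_symm_mul (σ : X ≅ X) (E F : FracSub X) (n : ℕ) :
    (twist σ.symm)^[n + 1] (E * twist σ F) =
      (twist σ.symm)^[n] F * (twist σ.symm)^[n] (twist σ.symm E) := by
  rw [Function.iterate_succ_apply, twist_mul, twist_symm_twist, iterate_twist_mul, mul_comm]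

lemma iterate_twist_symm_twistedPow (σ : X ≅ X) (E : FracSub X) (n : ℕ) :
    (twist σ.symm)^[n] (twistedPow σ E n) = twistedPow σ.symm (twist σ.symm E) n := by
  induction n with
  | zero => rfl
  | succ n ih =>
    rw [twistedPow_succ σ.symm, ← ih, ← iterate_twist_symm_mul]
    conv_lhs => rw [add_comm n 1, ← twistedPow_add, twistedPow_one, Function.iterate_one]
    rw [add_comm 1 n]

/-- Left ideals over `σ` correspond to right ideals over `σ⁻¹`. -/
lemma isLeftNoetherian_iff_stabilizes (hB : ∀ n, B.part n = twistedPow σ E n)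
    (hcoh : ∀ n F, IsQCoh F → F ≤ B.part n → IsCoh F) :
    IsLeftNoetherian B ↔ Stabilizes σ.symm (twist σ.symm E) := by
  have hinj (n : ℕ) : Function.Injective ((twist σ.symm)^[n] : FracSub X → FracSub X) :=
    (Function.LeftInverse.iterate (twist_twist_symm σ) n).injective
  constructor
  · intro h G hG hGE hGm
    have hkey (n : ℕ) : E * twist σ ((twist σ)^[n] (G n)) =
        (twist σ)^[n + 1] (G n * (twist σ.symm)^[n] (twist σ.symm E)) := by
      apply hinj (n + 1)
      rw [iterate_twist_symm_iterate_twist, iterate_twist_symm_mul,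
        iterate_twist_symm_iterate_twist]
    obtain ⟨d, hd⟩ := (LeftIdeal.isCoherent_iff hB hcoh _).1 (h (LeftIdeal.mk' hB
      (fun n => (twist σ)^[n] (G n)) (fun n => (hG n).iterate_twist σ n) (fun n => by
        rw [← iterate_twist_iterate_twist_symm σ (twistedPow σ E n) n,
          iterate_twist_symm_twistedPow]
        exact iterate_twist_mono σ n (hGE n)) fun n => by
        rw [hkey]
        exact iterate_twist_mono σ (n + 1) (hGm n)))
    refine ⟨d, fun n hn => ?_⟩
    have := (hd n hn).trans (hkey n)
    exact (Function.LeftInverse.iterate (twist_symm_twist σ) (n + 1)).injective this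
  · intro h P
    rw [LeftIdeal.isCoherent_iff hB hcoh]
    obtain ⟨d, hd⟩ := h (fun n => (twist σ.symm)^[n] (P.part n))
      (fun n => (P.isQCoh_part n).iterate_twist σ.symm n) (fun n => by
        rw [← iterate_twist_symm_twistedPow, ← hB]
        exact iterate_twist_mono σ.symm n (P.part_le n)) fun n => by
        rw [← iterate_twist_symm_mul]
        exact iterate_twist_mono σ.symm (n + 1) (P.mul_le hB n)
    refine ⟨d, fun n hn => hinj (n + 1) ?_⟩
    rw [iterate_twist_symm_mul]
    exact hd n hn

/-- For coherent right ideals `N ≤ P` which differ in infinitely many degrees, the factor `P / N`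
is not torsion. -/
lemma RightIdeal.not_factorIsTorsion {N P : RightIdeal B} (h : N ≤ P) (hP : P.IsCoherent)
    (hinf : {n | P.part n ≠ N.part n}.Infinite) : ¬ FactorIsTorsion N P := by
  intro ht
  -- The factor `P / N` is a coherent submodule of itself, generated by the images of generators of
  -- `P`.
  refine hinf (ht P h (fun _ => le_rfl) ?_)
  obtain ⟨d, C, hC, hP⟩ := hP
  refine ⟨d, C, hC, fun n => ?_⟩
  have h1 : P.part n = _ := (hP n).trans (bot_sup_eq _)
  rw [← h1, sup_eq_right.2 (h n)]

end Noetherian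

/-! ### Noetherianity of `X` and the ideal sheaf of a zero-dimensional subscheme -/

section Geometry

section Projective

attribute [local instance] MvPolynomial.gradedAlgebra

lemma IsProjective.isNoetherian {k : Type u} [Field k] {Y : Scheme.{u}}
    {f : Y ⟶ Spec (CommRingCat.of k)} (hf : IsProjective f) : AlgebraicGeometry.IsNoetherian Y := by
  obtain ⟨N, i, hi, -⟩ := hf
  let 𝒜 := MvPolynomial.homogeneousSubmodule (Fin (N + 1)) k
  have hsurj : Function.Surjective (algebraMap k (𝒜 0)) := by
    rintro ⟨p, hp⟩
    refine ⟨MvPolynomial.coeff 0 p, Subtype.ext ?_⟩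
    exact ((MvPolynomial.totalDegree_eq_zero_iff_eq_C).1
      ((MvPolynomial.totalDegree_zero_iff_isHomogeneous _).2 hp)).symm
  have : IsNoetherianRing (𝒜 0) := isNoetherianRing_of_surjective _ _ _ hsurj
  have : IsScalarTower k (𝒜 0) (MvPolynomial (Fin (N + 1)) k) :=
    ⟨fun a b c => smul_mul_assoc a (b : MvPolynomial (Fin (N + 1)) k) c⟩
  have : Algebra.FiniteType (𝒜 0) (MvPolynomial (Fin (N + 1)) k) :=
    Algebra.FiniteType.of_restrictScalars_finiteType k (𝒜 0) (MvPolynomial (Fin (N + 1)) k)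
  let g := i ≫ Proj.toSpecZero 𝒜
  have : IsLocallyNoetherian Y := LocallyOfFiniteType.isLocallyNoetherian g
  have : CompactSpace Y := QuasiCompact.compactSpace_of_compactSpace g
  constructor

end Projective

/-- In dimension zero every irreducible closed set is maximal. With T0 this makes each point closed
and an irreducible component, and a noetherian space has finitely many components. -/
lemma finite_and_isClosed_singleton_of_topologicalKrullDim_le_zero {α : Type*} [TopologicalSpace α]
    [T0Space α] [TopologicalSpace.NoetherianSpace α] (h : topologicalKrullDim α ≤ 0) :
    Finite α ∧ ∀ x : α, IsClosed {x} := by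
  have hmax := Order.krullDim_nonpos_iff_forall_isMax.1 h
  let Z (x : α) : TopologicalSpace.IrreducibleCloseds α :=
    ⟨closure {x}, isIrreducible_singleton.closure, isClosed_closure⟩
  have hcl (x : α) : closure {x} = {x} := by
    refine subset_antisymm (fun y hy => ?_) subset_closure
    have hle : Z y ≤ Z x := closure_minimal (Set.singleton_subset_iff.2 hy) isClosed_closure
    have hxy : closure {x} ⊆ closure {y} := hmax (Z y) hle
    have h1 : x ⤳ y := specializes_iff_mem_closure.2 hy
    have h2 : y ⤳ x := specializes_iff_mem_closure.2 (hxy (subset_closure rfl))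
    exact (h2.antisymm h1).eq
  refine ⟨?_, fun x => hcl x ▸ isClosed_closure⟩
  have hcomp (x : α) : {x} ∈ irreducibleComponents α := by
    refine ⟨isIrreducible_singleton, fun t ht hxt => ?_⟩
    have hle : Z x ≤ ⟨closure t, ht.closure, isClosed_closure⟩ := closure_mono hxt
    have hcx : closure t ⊆ closure {x} := hmax (Z x) hle
    exact subset_closure.trans (hcx.trans (hcl x).le)
  have := (TopologicalSpace.NoetherianSpace.finite_irreducibleComponents (α := α)).to_subtype
  exact Finite.of_injective (fun x => (⟨{x}, hcomp x⟩ : irreducibleComponents α))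
    fun x y hxy => Set.singleton_injective (congrArg Subtype.val hxy)

lemma ofIdealSheaf_le_one (I : X.IdealSheafData) : ofIdealSheaf I ≤ 1 := fun x => by
  refine Submodule.span_le.2 ?_
  rintro _ ⟨U, hx, a, -, rfl⟩
  exact mem_one_iff.2 ⟨_, rfl⟩

lemma one_notMem_ofIdealSheaf {I : X.IdealSheafData} {x : X} :
    1 ∉ ofIdealSheaf I x ↔ x ∈ I.support := by
  constructor
  · intro h
    by_contra hx
    apply h
    obtain ⟨U, hU, hxU⟩ := exists_affine_mem x
    rw [I.mem_support_iff_of_mem (U := ⟨U, hU⟩) hxU, Scheme.mem_zeroLocus_iff] at hx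
    push Not at hx
    obtain ⟨a, ha, hxa⟩ := hx
    have : Nonempty U := ⟨⟨x, hxU⟩⟩
    refine mem_of_germ_mul_mem hxa ?_
    rw [mul_one, ← Scheme.algebraMap_germ_eq_germToFunctionField X hxU]
    exact Submodule.subset_span ⟨⟨U, hU⟩, hxU, a, ha, rfl⟩
  · intro hx h
    refine one_notMem_maxSub x ((Submodule.span_le.2 ?_ : ofIdealSheaf I x ≤ maxSub X x) h)
    rintro _ ⟨U, hxU, a, ha, rfl⟩
    refine ⟨_, ?_, rfl⟩
    rw [I.mem_support_iff_of_mem (U := U) hxU, Scheme.mem_zeroLocus_iff] at hx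
    have := hx a ha
    rwa [X.mem_basicOpen _ x hxU] at this

/-- On a small affine neighbourhood, `I` vanishes at most at `c`, so its radical contains the prime
`p` of `c`. As `p` is finitely generated, `pʳ ⊆ I` for some `r`, and `p` generates the maximal ideal
of the stalk. -/
lemma exists_maxSub_pow_apply_le [IsLocallyNoetherian X] {I : X.IdealSheafData} {c : X}
    {V : X.Opens} (hcV : c ∈ V) (hV : ∀ x ∈ V, x ∈ I.support → x = c) :
    ∃ r : ℕ, (maxSub X ^ r) c ≤ ofIdealSheaf I c := by
  obtain ⟨_, ⟨U, hU, rfl⟩, hcU, hUV⟩ :=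
    X.isBasis_affineOpens.exists_subset_of_mem_open hcV V.isOpen
  have : Nonempty U := ⟨⟨c, hcU⟩⟩
  have : IsNoetherianRing Γ(X, U) := IsLocallyNoetherian.component_noetherian ⟨U, hU⟩
  let p : Ideal Γ(X, U) :=
    (IsLocalRing.maximalIdeal (X.presheaf.stalk c)).comap (X.presheaf.germ U c hcU).hom
  have hp {a : Γ(X, U)} : a ∈ p ↔ c ∉ X.basicOpen a := by
    rw [X.mem_basicOpen a c hcU, Ideal.mem_comap, IsLocalRing.mem_maximalIdeal, mem_nonunits_iff]
  have hrad : p ≤ (I.ideal ⟨U, hU⟩).radical := by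
    intro a ha
    refine exists_pow_mem_of_forall_mem_basicOpen hU _ a fun z hz => ?_
    have hzU : z ∈ U := X.basicOpen_le a hz
    have hzI : z ∉ I.support := by
      intro hz'
      rw [hV z (hUV hzU) hz'] at hz
      exact hp.1 ha hz
    rw [I.mem_support_iff_of_mem (U := ⟨U, hU⟩) hzU, Scheme.mem_zeroLocus_iff] at hzI
    push Not at hzI
    exact hzI
  obtain ⟨r, hr⟩ := Ideal.exists_pow_le_of_le_radical_of_fg hrad (IsNoetherian.noetherian p)
  refine ⟨r, ?_⟩
  let S (J : Ideal Γ(X, U)) : Submodule (X.presheaf.stalk c) X.functionField :=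
    Submodule.span _ (X.germToFunctionField U '' J)
  have hmax : maxSub X c ≤ S p := by
    rintro _ ⟨a, ha, rfl⟩
    obtain ⟨s, b, hs, hsb⟩ := exists_germ_mul_eq hU hcU a
    refine mem_of_germ_mul_mem (F := fun y => Submodule.span _ (X.germToFunctionField U '' p)) hs ?_
    rw [Algebra.linearMap_apply, hsb]
    refine Submodule.subset_span ⟨b, ?_, rfl⟩
    have : X.presheaf.germ U c hcU b = X.presheaf.germ U c hcU s * a := by
      apply algebraMap_stalk_injective c
      rw [map_mul, Scheme.algebraMap_germ_eq_germToFunctionField,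
        Scheme.algebraMap_germ_eq_germToFunctionField, hsb]
    change X.presheaf.germ U c hcU b ∈ IsLocalRing.maximalIdeal (X.presheaf.stalk c)
    rw [this]
    exact Ideal.mul_mem_left _ _ ha
  have hpow (n : ℕ) : (maxSub X ^ n) c ≤ S (p ^ n) := by
    induction n with
    | zero =>
      rw [pow_zero, Pi.one_apply, Submodule.one_le]
      exact Submodule.subset_span ⟨1, by simp, map_one _⟩
    | succ n ih =>
      rw [pow_succ, Pi.mul_apply]
      refine (mul_le_mul' ih hmax).trans ?_
      rw [Submodule.span_mul_span]
      refine Submodule.span_mono ?_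
      rintro _ ⟨_, ⟨a, ha, rfl⟩, _, ⟨b, hb, rfl⟩, rfl⟩
      exact ⟨a * b, by rw [pow_succ]; exact Ideal.mul_mem_mul ha hb, map_mul _ _ _⟩
  refine (hpow r).trans (Submodule.span_mono ?_)
  rintro _ ⟨a, ha, rfl⟩
  exact ⟨⟨U, hU⟩, hcU, a, hr ha, (Scheme.algebraMap_germ_eq_germToFunctionField X hcU a).symm⟩

lemma exists_maxSub_pow_le [IsLocallyNoetherian X] {I : X.IdealSheafData}
    (hfin : (I.support : Set X).Finite) (hcl : ∀ x ∈ I.support, IsClosed {x}) :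
    ∃ r : ℕ, maxSub X ^ r ≤ ofIdealSheaf I := by
  have key (c : X) (hc : c ∈ I.support) : ∃ r : ℕ, (maxSub X ^ r) c ≤ ofIdealSheaf I c := by
    have hcl' : IsClosed ((I.support : Set X) \ {c}) := by
      rw [← Set.biUnion_of_singleton ((I.support : Set X) \ {c})]
      exact hfin.sdiff.isClosed_biUnion fun y hy => hcl y hy.1
    exact exists_maxSub_pow_apply_le (V := ⟨_, hcl'.isOpen_compl⟩) (fun h => h.2 rfl)
      fun x hx hxI => by_contra fun hne => hx ⟨hxI, hne⟩
  choose! r hr using key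
  refine ⟨hfin.toFinset.sup r, fun x => ?_⟩
  by_cases hx : x ∈ I.support
  · refine le_trans ?_ (hr x hx)
    exact pow_le_pow_right_of_le_one' maxSub_le_one
      (Finset.le_sup (f := r) (hfin.mem_toFinset.2 hx)) x
  · refine (pow_le_one' maxSub_le_one _ x).trans (Submodule.one_le.2 ?_)
    exact not_not.1 (mt one_notMem_ofIdealSheaf.1 hx)

end Geometry

/-! ### Local generators of an invertible sheaf inside `K` -/

section Invertible

lemma presheaf_map_map {Y : Scheme.{u}} (L : Y.Modules) {V₁ V₂ V₃ : Y.Opens} (h : V₁ ≤ V₂) (h' : V₂ ≤ V₃)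
    (t : Γ(L, V₃)) : L.presheaf.map (homOfLE h).op (L.presheaf.map (homOfLE h').op t) =
      L.presheaf.map (homOfLE (h.trans h')).op t := by
  rw [← ConcreteCategory.comp_apply, ← Functor.map_comp]
  rfl

lemma germ_ne_zero {U : X.Opens} {x : X} (hx : x ∈ U) {a : Γ(X, U)} (ha : a ≠ 0) :
    X.presheaf.germ U x hx a ≠ 0 := fun h =>
  ha (germ_injective_of_isIntegral X x hx (h.trans (map_zero _).symm))

/-- A nonzero section of an invertible sheaf on an integral scheme has nonzero restrictions. -/
lemma IsInvertible.map_ne_zero {L : X.Modules} (hL : IsInvertible L) {W V : X.Opens}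
    {s : Γ(L, W)} (hs : s ≠ 0) (hVW : V ≤ W) (hV : genericPoint X ∈ V) :
    L.presheaf.map (homOfLE hVW).op s ≠ 0 := by
  intro h0
  choose U u hxU hu using hL.exists_generator
  apply hs
  refine TopCat.Sheaf.eq_of_locally_eq' ⟨L.presheaf, L.isSheaf⟩ (fun x : W => W ⊓ U x.1) W
    (fun x => homOfLE inf_le_left) (fun x hx => TopologicalSpace.Opens.mem_iSup.2
      ⟨⟨x, hx⟩, hx, hxU x⟩) s 0 fun x => ?_
  rw [map_zero]
  obtain ⟨h, hh⟩ := (hu x.1 (W ⊓ U x.1) inf_le_right).2 (L.presheaf.map (homOfLE inf_le_left).op s)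
  suffices h = 0 by
    refine hh.symm.trans ?_
    simp only [this, zero_smul]
  have hηU : genericPoint X ∈ U x.1 :=
    (genericPoint_specializes x.1).mem_open (U x.1).isOpen (hxU x.1)
  have hle : V ⊓ U x.1 ≤ W ⊓ U x.1 := inf_le_inf_right _ hVW
  have h1 : X.presheaf.map (homOfLE hle).op h = 0 := by
    apply (hu x.1 (V ⊓ U x.1) inf_le_right).1
    have h2 := congrArg (L.presheaf.map (homOfLE hle).op) hh
    rw [Scheme.Modules.map_smul, presheaf_map_map, presheaf_map_map] at h2
    simp only [zero_smul]
    rw [h2, ← presheaf_map_map L inf_le_left hVW, h0, map_zero]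
  by_contra hne
  refine germ_ne_zero (x := genericPoint X) (⟨hVW hV, hηU⟩ : genericPoint X ∈ W ⊓ U x.1) hne ?_
  rw [← X.presheaf.germ_res_apply (homOfLE hle) (genericPoint X) ⟨hV, hηU⟩ h, h1, map_zero]

/-- Locally, an invertible subsheaf of `K` is generated by one nonzero rational function. -/
lemma exists_ofInvertible_eq_span {L : X.Modules} (hL : IsInvertible L) {W : X.Opens}
    {s : Γ(L, W)} (hs : s ≠ 0) (x : X) : ∃ U : X.Opens, x ∈ U ∧ ∃ f : X.functionField, f ≠ 0 ∧
      ∀ y ∈ U, ofInvertible L s y = Submodule.span (X.presheaf.stalk y) {f} := by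
  obtain ⟨U, u, hxU, hu⟩ := hL.exists_generator x
  have hηU : genericPoint X ∈ U := (genericPoint_specializes x).mem_open U.isOpen hxU
  -- Otherwise `W` is empty, the empty family covers it, and the sheaf axiom forces `s = 0`.
  have hηW : genericPoint X ∈ W := by
    by_contra hW
    apply hs
    refine TopCat.Sheaf.eq_of_locally_eq' ⟨L.presheaf, L.isSheaf⟩ (fun i : Empty => i.elim) W
      (fun i => i.elim) (fun y hy => ?_) s 0 fun i => i.elim
    exact (hW ((genericPoint_specializes y).mem_open W.isOpen hy)).elim
  have hη0 : genericPoint X ∈ W ⊓ U := ⟨hηW, hηU⟩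
  obtain ⟨h, hh⟩ := (hu (W ⊓ U) inf_le_right).2 (L.presheaf.map (homOfLE inf_le_left).op s)
  have h0 : h ≠ 0 := by
    rintro rfl
    refine hL.map_ne_zero hs (inf_le_left : W ⊓ U ≤ W) hη0 ?_
    rw [← hh]
    simp only [zero_smul]
  -- On `W ⊓ U` one has `s = h u`, so the local generator `u` of `L` becomes the rational function
  -- `u / s = 1 / h`.
  let hf : X.functionField := X.presheaf.germ (W ⊓ U) (genericPoint X) hη0 h
  have hf0 : hf ≠ 0 := germ_ne_zero hη0 h0
  refine ⟨U, hxU, hf⁻¹, inv_ne_zero hf0, fun y hy => ?_⟩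
  apply le_antisymm
  · refine Submodule.span_le.2 ?_
    rintro f ⟨U', t, hyU', V, hVU', hVW, hη, g, rfl, htg⟩
    obtain ⟨r, hr⟩ := (hu (U' ⊓ U) inf_le_right).2 (L.presheaf.map (homOfLE inf_le_left).op t)
    have hηV : genericPoint X ∈ V ⊓ U := ⟨hη, hηU⟩
    have hη' : genericPoint X ∈ U' ⊓ U := ⟨hVU' hη, hηU⟩
    have hgh : X.presheaf.map (homOfLE (inf_le_left : V ⊓ U ≤ V)).op g *
        X.presheaf.map (homOfLE (inf_le_inf_right U hVW)).op h =
          X.presheaf.map (homOfLE (inf_le_inf_right U hVU')).op r := by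
      apply (hu (V ⊓ U) inf_le_right).1
      have e1 := congrArg (L.presheaf.map (homOfLE (inf_le_inf_right U hVW)).op) hh
      have e2 := congrArg (L.presheaf.map (homOfLE (inf_le_inf_right U hVU')).op) hr
      have e3 := congrArg (L.presheaf.map (homOfLE (inf_le_left : V ⊓ U ≤ V)).op) htg
      rw [Scheme.Modules.map_smul, presheaf_map_map, presheaf_map_map] at e1 e2
      rw [Scheme.Modules.map_smul, presheaf_map_map, presheaf_map_map] at e3
      change (_ * _) • _ = _ • _
      rw [mul_smul, e1, e2, e3]
    have e := congrArg (X.presheaf.germ (V ⊓ U) (genericPoint X) hηV) hgh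
    rw [map_mul, X.presheaf.germ_res_apply, X.presheaf.germ_res_apply,
      X.presheaf.germ_res_apply] at e
    have hne : Nonempty (U' ⊓ U : X.Opens) := ⟨⟨y, hyU', hy⟩⟩
    have e' : X.presheaf.germ V (genericPoint X) hη g =
        X.germToFunctionField (U' ⊓ U) r * hf⁻¹ := (eq_mul_inv_iff_mul_eq₀ hf0).2 e
    rw [e', ← Scheme.algebraMap_germ_eq_germToFunctionField X (x := y)
      (show y ∈ U' ⊓ U from ⟨hyU', hy⟩),
      ← Algebra.smul_def]
    exact Submodule.smul_mem _ _ (Submodule.mem_span_singleton_self _)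
  · refine Submodule.span_le.2 (Set.singleton_subset_iff.2 (Submodule.subset_span ?_))
    have hV₁ : X.basicOpen h ≤ W ⊓ U := X.basicOpen_le h
    have hη1 : genericPoint X ∈ X.basicOpen h := by
      rw [X.mem_basicOpen h _ hη0]
      exact isUnit_iff_ne_zero.2 hf0
    have hunit : IsUnit (X.presheaf.map (homOfLE hV₁).op h) :=
      RingedSpace.isUnit_res_basicOpen X.toRingedSpace h
    obtain ⟨v, hv⟩ := hunit.exists_left_inv
    refine ⟨U, u, hy, X.basicOpen h, hV₁.trans inf_le_right, hV₁.trans inf_le_left, hη1, v, ?_, ?_⟩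
    · have e := congrArg (X.presheaf.germ _ (genericPoint X) hη1) hv
      rw [map_mul, X.presheaf.germ_res_apply, map_one] at e
      exact eq_inv_of_mul_eq_one_left e
    · have e := congrArg (fun t => v • L.presheaf.map (homOfLE hV₁).op t) hh
      simp only [Scheme.Modules.map_smul, presheaf_map_map, smul_smul] at e
      rw [hv, one_smul] at e
      exact e

end Invertible

/-! ### Inverses of invertible subsheaves, and coherence -/

section Coherent

/-- The stalks of `M` are defined with an independent choice of generator at each point; uniqueness
of inverses shows that on `U x` they are all generated by the single function `(f x)⁻¹`. -/
lemma exists_isQCoh_mul_eq_one {F : FracSub X} (hF : ∀ x : X, ∃ U : X.Opens, x ∈ U ∧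
    ∃ f : X.functionField, f ≠ 0 ∧ ∀ y ∈ U, F y = Submodule.span (X.presheaf.stalk y) {f}) :
    ∃ M : FracSub X, IsQCoh M ∧ F * M = 1 := by
  choose U hxU f hf0 hf using hF
  let M : FracSub X := fun x => Submodule.span _ {(f x)⁻¹}
  have key (x y : X) (hy : y ∈ U x) :
      F y * Submodule.span (X.presheaf.stalk y) {(f x)⁻¹} = 1 := by
    rw [hf x y hy, Submodule.span_mul_span, Set.singleton_mul_singleton, mul_inv_cancel₀ (hf0 x),
      Submodule.one_eq_span]
  refine ⟨M, fun x => ⟨U x, hxU x, {(f x)⁻¹}, fun y hy => ?_⟩, funext fun y => key y y (hxU y)⟩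
  calc M y = M y * (F y * Submodule.span (X.presheaf.stalk y) {(f x)⁻¹}) := by
        rw [key x y hy, mul_one]
    _ = F y * M y * Submodule.span (X.presheaf.stalk y) {(f x)⁻¹} := by ring
    _ = Submodule.span (X.presheaf.stalk y) {(f x)⁻¹} := by rw [key y y (hxU y), one_mul]

lemma isCoh_one : IsCoh (1 : FracSub X) := fun _ =>
  ⟨⊤, trivial, {1}, Set.finite_singleton 1, fun _ _ => Submodule.one_eq_span⟩

lemma IsCoh.mul {F G : FracSub X} (hF : IsCoh F) (hG : IsCoh G) : IsCoh (F * G) := fun x => by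
  obtain ⟨U, hU, S, hSf, hS⟩ := hF x
  obtain ⟨V, hV, T, hTf, hT⟩ := hG x
  refine ⟨U ⊓ V, ⟨hU, hV⟩, S * T, hSf.mul hTf, fun y hy => ?_⟩
  rw [Pi.mul_apply, hS y hy.1, hT y hy.2, Submodule.span_mul_span]

lemma IsCoh.twist {F : FracSub X} (hF : IsCoh F) (σ : X ≅ X) : IsCoh (twist σ F) := fun x => by
  obtain ⟨U, hU, T, hTf, hT⟩ := hF (σ.hom x)
  exact ⟨σ.hom ⁻¹ᵁ U, hU, funPullback σ '' T, hTf.image _,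
    fun y hy => twist_eq_span σ F y T (hT _ hy)⟩

lemma IsCoh.twistedPow {F : FracSub X} (hF : IsCoh F) (σ : X ≅ X) (n : ℕ) :
    IsCoh (twistedPow σ F n) := by
  have key : ∀ i, IsCoh ((NaiveBlowup.twist σ)^[i] F) := fun i => by
    induction i with
    | zero => exact hF
    | succ i ih => rw [Function.iterate_succ_apply']; exact ih.twist σ
  exact Finset.prod_induction _ IsCoh (fun _ _ h h' => h.mul h') isCoh_one fun i _ => key i

/-- On a locally noetherian scheme, a quasi-coherent subsheaf of `∏ᵢ (I L)^{σⁱ}`, with `I` an ideal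
sheaf and `L` invertible, is coherent. -/
lemma IsQCoh.isCoh_of_le_twistedPow [IsLocallyNoetherian X] {σ : X ≅ X} {I L M F : FracSub X}
    (h1 : I ≤ 1) (hL : IsCoh L) (hM : IsQCoh M) (hLM : L * M = 1) {n : ℕ} (hF : IsQCoh F)
    (hle : F ≤ NaiveBlowup.twistedPow σ I n * NaiveBlowup.twistedPow σ L n) : IsCoh F := by
  have hpow : NaiveBlowup.twistedPow σ L n * NaiveBlowup.twistedPow σ M n = 1 := by
    rw [← twistedPow_mul, hLM, NaiveBlowup.twistedPow]
    exact Finset.prod_eq_one fun i _ => iterate_twist_one σ i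
  have e : F * NaiveBlowup.twistedPow σ M n * NaiveBlowup.twistedPow σ L n = F := by
    rw [mul_assoc, mul_comm (NaiveBlowup.twistedPow σ M n), hpow, mul_one]
  rw [← e]
  refine ((hF.mul (hM.twistedPow σ n)).isCoh ?_).mul (hL.twistedPow σ n)
  refine (mul_le_mul_left hle _).trans ?_
  rw [mul_assoc, hpow, mul_one]
  exact twistedPow_le_one σ h1 n

end Coherent

/-! ### Ideal sheaves of finitely many points of infinite order -/

section PointIdeal

/-- The ideal sheaf `J` of a zero-dimensional or empty closed subscheme, all of whose points are of
infinite order under `σ`. -/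
structure IsPointIdeal (σ : X ≅ X) (J : FracSub X) : Prop where
  isQCoh : IsQCoh J
  le_one : J ≤ 1
  ne_bot (x : X) : J x ≠ ⊥
  finite : {x | 1 ∉ J x}.Finite
  isClosed (x : X) : 1 ∉ J x → IsClosed {x}
  pow_ne (x : X) : 1 ∉ J x → ∀ n : ℕ, 0 < n → (pointPerm σ ^ n) x ≠ x
  exists_maxSub_pow_le : ∃ r : ℕ, maxSub X ^ r ≤ J

/-- This lets the criterion for right ideals be applied to `σ⁻¹`, which settles left ideals. -/
lemma IsPointIdeal.twist_symm {σ : X ≅ X} {J : FracSub X} (h : IsPointIdeal σ J) :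
    IsPointIdeal σ.symm (twist σ.symm J) where
  isQCoh := h.isQCoh.twist σ.symm
  le_one := (twist_mono σ.symm h.le_one).trans_eq (twist_one σ.symm)
  ne_bot := iterate_twist_apply_ne_bot σ.symm h.ne_bot 1
  finite := by
    simp only [one_mem_twist]
    exact h.finite.preimage (pointPerm σ.symm).injective.injOn
  isClosed x hx := by
    rw [one_mem_twist] at hx
    have := (h.isClosed _ hx).preimage σ.symm.hom.continuous
    convert this using 1
    ext y
    exact ((pointPerm σ.symm).injective.eq_iff (a := y) (b := x)).symm
  pow_ne x hx n hn e := by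
    rw [one_mem_twist] at hx
    refine h.pow_ne _ hx n hn ?_
    rw [pointPerm_symm, inv_pow, Equiv.Perm.inv_eq_iff_eq] at e
    change (pointPerm σ ^ n) ((pointPerm σ)⁻¹ x) = (pointPerm σ)⁻¹ x
    rw [← Equiv.Perm.mul_apply, ← (Commute.self_pow (pointPerm σ) n).inv_left.eq,
      Equiv.Perm.mul_apply, ← e]
  exists_maxSub_pow_le := by
    obtain ⟨r, hr⟩ := h.exists_maxSub_pow_le
    exact ⟨r, (iterate_twist_maxSub_pow σ.symm 1 r).symm.trans_le (twist_mono σ.symm hr)⟩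

lemma genericPoint_notMem_of_isClosed {Y : Set X} (hY : IsClosed Y) (hne : Y ≠ Set.univ) :
    genericPoint X ∉ Y := fun h => hne <| Set.univ_subset_iff.1 fun x _ =>
  (genericPoint_specializes x).mem_closed hY h

/-- The half-orbit is infinite because `c` has infinite order, so critical density fails through an
infinite subset `D` that is not dense. The ideal sheaf `V` is the vanishing ideal of the closure of
`D`. -/
lemma IsPointIdeal.exists_sparseOrbit {σ : X ≅ X} {J : FracSub X}
    (h : IsPointIdeal σ J) {c : X} (hc : 1 ∉ J c)
    (hcd : ¬ CriticallyDense {x : X | ∃ i : ℕ, x = (pointPerm σ ^ (-(i : ℤ))) c}) :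
    Nonempty (SparseOrbit σ J) := by
  have hinj : Function.Injective fun i : ℕ => (pointPerm σ ^ (-(i : ℤ))) c := fun i j e => by
    have := injective_zpow_apply _ (h.pow_ne c hc) e
    omega
  have hrange : {x : X | ∃ i : ℕ, x = (pointPerm σ ^ (-(i : ℤ))) c} =
      Set.range fun i : ℕ => (pointPerm σ ^ (-(i : ℤ))) c := by
    ext x
    exact exists_congr fun i => eq_comm
  rw [hrange, CriticallyDense] at hcd
  push Not at hcd
  obtain ⟨D, hDC, hD, hne⟩ := hcd (Set.infinite_range_of_injective hinj)
  let Z : TopologicalSpace.Closeds X := ⟨closure D, isClosed_closure⟩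
  let I : X.IdealSheafData := Scheme.IdealSheafData.vanishingIdeal Z
  have hI (x : X) : 1 ∉ ofIdealSheaf I x ↔ x ∈ closure D := by
    rw [one_notMem_ofIdealSheaf]
    rfl
  obtain ⟨r, hr⟩ := h.exists_maxSub_pow_le
  refine ⟨⟨h.isQCoh, h.le_one, h.ne_bot, c, h.isQCoh.unitAt h.le_one h.finite h.isClosed hc, hc,
    h.pow_ne c hc, r, hr, ofIdealSheaf I, isQCoh_ofIdealSheaf I, ofIdealSheaf_le_one I,
    (isQCoh_ofIdealSheaf I).ne_bot rfl (not_not.1 fun h' =>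
      genericPoint_notMem_of_isClosed isClosed_closure hne ((hI _).1 h')), fun hfin => hD ?_⟩⟩
  refine (hfin.image fun i : ℕ => (pointPerm σ ^ (-(i : ℤ))) c).subset fun x hx => ?_
  obtain ⟨i, rfl⟩ := hDC hx
  exact ⟨i, (hI _).2 (subset_closure hx), rfl⟩

lemma IsPointIdeal.stabilizes_iff [AlgebraicGeometry.IsNoetherian X] {σ : X ≅ X} {J : FracSub X}
    (h : IsPointIdeal σ J) : Stabilizes σ J ↔
      ∀ c, 1 ∉ J c → CriticallyDense {x : X | ∃ i : ℕ, x = (pointPerm σ ^ (-(i : ℤ))) c} := by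
  refine ⟨fun hs c hc => by_contra fun hcd => ?_,
    stabilizes_of_criticallyDense h.isQCoh h.le_one h.finite h.pow_ne⟩
  obtain ⟨O⟩ := h.exists_sparseOrbit hc hcd
  exact O.not_stabilizes hs

lemma IsPointIdeal.exists_chain [IsLocallyNoetherian X] {σ : X ≅ X} {J : FracSub X}
    (h : IsPointIdeal σ J) (hcd : ¬ ∀ c, 1 ∉ J c →
      CriticallyDense {x : X | ∃ i : ℕ, x = (pointPerm σ ^ (-(i : ℤ))) c}) :
    ∃ G : ℕ → ℕ → FracSub X,
    (∀ n j, IsQCoh (G n j)) ∧ (∀ n j, G n j ≤ twistedPow σ J j) ∧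
    (∀ n j, G n j * (twist σ)^[j] J ≤ G n (j + 1)) ∧
    (∀ n, ∃ d, ∀ j ≥ d, G n (j + 1) = G n j * (twist σ)^[j] J) ∧
    (∀ n j, G n j ≤ G (n + 1) j) ∧ ∀ n, {j | G (n + 1) j ≠ G n j}.Infinite := by
  push Not at hcd
  obtain ⟨c, hc, hcd⟩ := hcd
  obtain ⟨O⟩ := h.exists_sparseOrbit hc hcd
  exact O.exists_chain

lemma isPointIdeal_ofIdealSheaf [AlgebraicGeometry.IsNoetherian X] {σ : X ≅ X}
    {I : X.IdealSheafData} (hI : topologicalKrullDim I.support ≤ 0)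
    (hord : ∀ p ∈ I.support, ∀ n : ℕ, 0 < n → (pointPerm σ ^ n) p ≠ p) :
    IsPointIdeal σ (ofIdealSheaf I) := by
  have : TopologicalSpace.NoetherianSpace I.support :=
    Topology.IsInducing.subtypeVal.noetherianSpace
  obtain ⟨hfin, hcl⟩ := finite_and_isClosed_singleton_of_topologicalKrullDim_le_zero hI
  have hfin' : (I.support : Set X).Finite := Set.toFinite _
  have hcl' (x : X) (hx : x ∈ I.support) : IsClosed {x} := by
    have := I.support.isClosed.isClosedEmbedding_subtypeVal.isClosedMap _ (hcl ⟨x, hx⟩)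
    rwa [Set.image_singleton] at this
  -- The generic point is fixed by `σ`, so it is not of infinite order; hence the ideal sheaf is
  -- nonzero, even when `X` is a point.
  have hη : genericPoint X ∉ I.support := fun h =>
    hord _ h 1 one_pos (by rw [pow_one]; exact genericPoint_eq_of_isOpenImmersion σ.hom)
  have hη' : 1 ∈ ofIdealSheaf I (genericPoint X) := not_not.1 (mt one_notMem_ofIdealSheaf.1 hη)
  exact
    { isQCoh := isQCoh_ofIdealSheaf I
      le_one := ofIdealSheaf_le_one I
      ne_bot := (isQCoh_ofIdealSheaf I).ne_bot rfl hη'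
      finite := by simp only [one_notMem_ofIdealSheaf]; exact hfin'
      isClosed := fun x hx => hcl' x (one_notMem_ofIdealSheaf.1 hx)
      pow_ne := fun x hx => hord x (one_notMem_ofIdealSheaf.1 hx)
      exists_maxSub_pow_le := NaiveBlowup.exists_maxSub_pow_le hfin' hcl' }

end PointIdeal

/-! ### Full orbits and half-orbits -/

section Saturating

lemma CriticallyDense.subset {Y : Scheme.{u}} {C D : Set Y} (hC : CriticallyDense C) (hDC : D ⊆ C)
    (hD : D.Infinite) : CriticallyDense D :=
  ⟨hD, fun _ h => hC.2 _ (h.trans hDC)⟩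

lemma CriticallyDense.union {Y : Scheme.{u}} {C D : Set Y} (hC : CriticallyDense C)
    (hD : CriticallyDense D) : CriticallyDense (C ∪ D) := by
  refine ⟨hC.1.mono Set.subset_union_left, fun A hA hinf => ?_⟩
  rw [← Set.inter_eq_left.2 hA, Set.inter_union_distrib_left, Set.infinite_union] at hinf
  rcases hinf with h | h
  · exact Set.univ_subset_iff.1 ((hC.2 _ Set.inter_subset_right h).symm.trans_subset
      (closure_mono Set.inter_subset_left))
  · exact Set.univ_subset_iff.1 ((hD.2 _ Set.inter_subset_right h).symm.trans_subset
      (closure_mono Set.inter_subset_left))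

/-- The orbit is the union of `{σ⁻ⁱ(c) : i ≥ 0}` and `{σⁱ(c) : i ≥ 1}`. The forward half starts at
`σ(c)`, not at `c`, because `I^{σ⁻¹}` is supported on `σ(S)`. -/
lemma criticallyDense_zpow_iff {Y : Scheme.{u}} (σ : Y ≅ Y) {c : Y}
    (hc : ∀ n : ℕ, 0 < n → (pointPerm σ ^ n) c ≠ c) :
    CriticallyDense {x : Y | ∃ i : ℤ, x = (pointPerm σ ^ (-i)) c} ↔
      CriticallyDense {x : Y | ∃ i : ℕ, x = (pointPerm σ.symm ^ (-(i : ℤ))) (pointPerm σ c)} ∧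
        CriticallyDense {x : Y | ∃ i : ℕ, x = (pointPerm σ ^ (-(i : ℤ))) c} := by
  have hinj := injective_zpow_apply _ hc
  have e (i : ℕ) : (pointPerm σ.symm ^ (-(i : ℤ))) (pointPerm σ c) =
      (pointPerm σ ^ ((i : ℤ) + 1)) c := by
    rw [pointPerm_symm, inv_zpow', neg_neg, zpow_add_one]; rfl
  simp only [e]
  constructor
  · intro h
    refine ⟨h.subset ?_ ?_, h.subset ?_ ?_⟩
    · rintro _ ⟨i, rfl⟩
      exact ⟨-((i : ℤ) + 1), by rw [neg_neg]⟩
    · refine (Set.infinite_range_of_injective (f := fun i : ℕ => (pointPerm σ ^ ((i : ℤ) + 1)) c)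
        fun i j hij => by have := hinj hij; omega).mono ?_
      rintro _ ⟨i, rfl⟩
      exact ⟨i, rfl⟩
    · rintro _ ⟨i, rfl⟩
      exact ⟨i, rfl⟩
    · refine (Set.infinite_range_of_injective (f := fun i : ℕ => (pointPerm σ ^ (-(i : ℤ))) c)
        fun i j hij => by have := hinj hij; omega).mono ?_
      rintro _ ⟨i, rfl⟩
      exact ⟨i, rfl⟩
  · rintro ⟨h1, h2⟩
    refine (h1.union h2).subset ?_ (h2.1.mono ?_)
    · rintro _ ⟨i, rfl⟩
      rcases lt_or_ge i 0 with hi | hi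
      · exact Or.inl ⟨(-i - 1).toNat, by rw [Int.toNat_of_nonneg (by omega), sub_add_cancel]⟩
      · exact Or.inr ⟨i.toNat, by rw [Int.toNat_of_nonneg hi]⟩
    · rintro _ ⟨i, rfl⟩
      exact ⟨i, rfl⟩

end Saturating

/-! ### The theorem for the naive blowup algebra -/

section Main

lemma naiveBlowup_part {σ : X ≅ X} {L : X.Modules} {hL : IsInvertible L}
    {W : X.Opens} {s : Γ(L, W)} {I : X.IdealSheafData} (n : ℕ) :
    (naiveBlowup σ I L hL s).part n =
    twistedPow σ (ofIdealSheaf I * ofInvertible L s) n :=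
  (twistedPow_mul σ _ _ n).symm

variable [AlgebraicGeometry.IsNoetherian X] {σ : X ≅ X} {L : X.Modules} {hL : IsInvertible L}
  {W : X.Opens} {s : Γ(L, W)} {I : X.IdealSheafData}

lemma isCoh_of_le_naiveBlowup_part (hs : s ≠ 0) (n : ℕ) (F : FracSub X) (hF : IsQCoh F)
    (hle : F ≤ (naiveBlowup σ I L hL s).part n) : IsCoh F := by
  obtain ⟨M, hM, hLM⟩ := exists_isQCoh_mul_eq_one (exists_ofInvertible_eq_span hL hs)
  refine IsQCoh.isCoh_of_le_twistedPow (ofIdealSheaf_le_one I) (fun x => ?_) hM hLM hF hle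
  obtain ⟨U, hxU, f, -, hf⟩ := exists_ofInvertible_eq_span hL hs x
  exact ⟨U, hxU, {f}, Set.finite_singleton f, hf⟩

lemma isRightNoetherian_naiveBlowup_iff (hs : s ≠ 0)
    (hI : IsPointIdeal σ (ofIdealSheaf I)) :
    IsRightNoetherian (naiveBlowup σ I L hL s) ↔ RightSaturating σ I := by
  obtain ⟨M, hM, hLM⟩ := exists_isQCoh_mul_eq_one (exists_ofInvertible_eq_span hL hs)
  rw [isRightNoetherian_iff_stabilizes naiveBlowup_part (isCoh_of_le_naiveBlowup_part hs),
    stabilizes_mul_iff (isQCoh_ofInvertible hL s) hM hLM, hI.stabilizes_iff]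
  simp only [one_notMem_ofIdealSheaf]
  rfl

lemma isNoetherian_naiveBlowup_iff (hs : s ≠ 0)
    (hI : IsPointIdeal σ (ofIdealSheaf I)) :
    IsNoetherian (naiveBlowup σ I L hL s) ↔ Saturating σ I := by
  obtain ⟨M, hM, hLM⟩ := exists_isQCoh_mul_eq_one (exists_ofInvertible_eq_span hL hs)
  rw [IsNoetherian, isRightNoetherian_naiveBlowup_iff hs hI,
    isLeftNoetherian_iff_stabilizes naiveBlowup_part (isCoh_of_le_naiveBlowup_part hs),
    twist_mul, stabilizes_mul_iff ((isQCoh_ofInvertible hL s).twist σ.symm) (hM.twist σ.symm)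
      (by rw [← twist_mul, hLM, twist_one]), hI.twist_symm.stabilizes_iff]
  have hord (c : X) (hc : c ∈ I.support) := hI.pow_ne c (one_notMem_ofIdealSheaf.2 hc)
  constructor
  · rintro ⟨h1, h2⟩ c hc
    -- Here `h1` is the condition for left ideals, which ranges over the points of `σ(S)`.
    refine (criticallyDense_zpow_iff σ (hord c hc)).2 ⟨h1 (pointPerm σ c) ?_, h2 c hc⟩
    rw [one_mem_twist]
    have e : σ.symm.hom (pointPerm σ c) = c := (pointPerm σ).symm_apply_apply c
    rw [mem_iff_of_eq _ e]
    exact one_notMem_ofIdealSheaf.2 hc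
  · intro h
    refine ⟨fun c' hc' => ?_, fun c hc => ((criticallyDense_zpow_iff σ (hord c hc)).1 (h c hc)).2⟩
    rw [one_mem_twist, one_notMem_ofIdealSheaf] at hc'
    have e : pointPerm σ (σ.symm.hom c') = c' := (pointPerm σ).apply_symm_apply c'
    have := ((criticallyDense_zpow_iff σ (hord _ hc')).1 (h _ hc')).1
    rwa [e] at this

/-- The chain for the ideal sheaf alone is multiplied by `Lⱼ` in degree `j`. As `Lⱼ` is invertible,
consecutive terms still differ in infinitely many degrees, so no factor is torsion. -/
lemma exists_chain_naiveBlowup (hs : s ≠ 0) (hI : IsPointIdeal σ (ofIdealSheaf I))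
    (h : ¬ IsRightNoetherian (naiveBlowup σ I L hL s)) :
    ∃ M : ℕ → RightIdeal (naiveBlowup σ I L hL s), (∀ n, (M n).IsCoherent) ∧
      (∀ n, M n ≤ M (n + 1)) ∧ ∀ n, ¬ RightIdeal.FactorIsTorsion (M n) (M (n + 1)) := by
  obtain ⟨M, hM, hLM⟩ := exists_isQCoh_mul_eq_one (exists_ofInvertible_eq_span hL hs)
  rw [isRightNoetherian_naiveBlowup_iff hs hI] at h
  obtain ⟨G, hG, hGI, hGm, hGd, hGle, hGne⟩ := hI.exists_chain
    (by simp only [one_notMem_ofIdealSheaf]; exact h)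
  let E := ofIdealSheaf I * ofInvertible L s
  have hEn (n j : ℕ) : G n j * twistedPow σ (ofInvertible L s) j * (twist σ)^[j] E =
      G n j * (twist σ)^[j] (ofIdealSheaf I) * twistedPow σ (ofInvertible L s) (j + 1) := by
    rw [iterate_twist_mul, twistedPow_succ]; ring
  let P (n : ℕ) : RightIdeal (naiveBlowup σ I L hL s) := RightIdeal.mk' naiveBlowup_part
    (fun j => G n j * twistedPow σ (ofInvertible L s) j)
    (fun j => (hG n j).mul ((isQCoh_ofInvertible hL s).twistedPow σ j))
    (fun j => (mul_le_mul_left (hGI n j) _).trans_eq (twistedPow_mul σ _ _ j).symm)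
    (fun j => (hEn n j).trans_le (mul_le_mul_left (hGm n j) _))
  have hP (n : ℕ) : (P n).IsCoherent := by
    rw [RightIdeal.isCoherent_iff naiveBlowup_part (isCoh_of_le_naiveBlowup_part hs)]
    obtain ⟨d, hd⟩ := hGd n
    refine ⟨d, fun j hj => Eq.trans ?_ (hEn n j).symm⟩
    rw [← hd j hj]
    rfl
  have hle (n : ℕ) : P n ≤ P (n + 1) := fun j => mul_le_mul_left (hGle n j) _
  have hcancel (n j : ℕ) (e : (P (n + 1)).part j = (P n).part j) : G (n + 1) j = G n j := by
    have hpow : twistedPow σ (ofInvertible L s) j * twistedPow σ M j = 1 := by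
      rw [← twistedPow_mul, hLM, twistedPow]
      exact Finset.prod_eq_one fun i _ => iterate_twist_one σ i
    have := congrArg (· * twistedPow σ M j) e
    change G (n + 1) j * twistedPow σ (ofInvertible L s) j * twistedPow σ M j =
      G n j * twistedPow σ (ofInvertible L s) j * twistedPow σ M j at this
    rwa [mul_assoc, mul_assoc, hpow, mul_one, mul_one] at this
  refine ⟨P, hP, hle, fun n => RightIdeal.not_factorIsTorsion (hle n) (hP (n + 1)) ?_⟩
  exact (hGne n).mono fun j (hj : G (n + 1) j ≠ G n j) e => hj (hcancel n j e)

end Main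

end NaiveBlowup

theorem mainTheorem3 {k : Type u} [Field k] [IsAlgClosed k] {X : Scheme.{u}} [IsIntegral X]
    (f : X ⟶ Spec (CommRingCat.of k)) (hf : NaiveBlowup.IsProjective f)
    (σ : X ≅ X) (hσ : σ.hom ≫ f = f)
    (L : X.Modules) (hL : NaiveBlowup.IsInvertible L)
    (W : X.Opens) (s : Γ(L, W)) (hs : s ≠ 0)
    (I : X.IdealSheafData) (hI : topologicalKrullDim I.support ≤ 0)
    (hord : ∀ p ∈ I.support, ∀ n : ℕ, 0 < n → (NaiveBlowup.pointPerm σ ^ n) p ≠ p) :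
    (NaiveBlowup.IsRightNoetherian (NaiveBlowup.naiveBlowup σ I L hL s) ↔
        NaiveBlowup.RightSaturating σ I) ∧
      (NaiveBlowup.IsNoetherian (NaiveBlowup.naiveBlowup σ I L hL s) ↔
        NaiveBlowup.Saturating σ I) ∧
      (¬ NaiveBlowup.IsRightNoetherian (NaiveBlowup.naiveBlowup σ I L hL s) →
        ∃ M : ℕ → NaiveBlowup.RightIdeal (NaiveBlowup.naiveBlowup σ I L hL s),
          (∀ n, (M n).IsCoherent) ∧ (∀ n, M n ≤ M (n + 1)) ∧
            ∀ n, ¬ NaiveBlowup.RightIdeal.FactorIsTorsion (M n) (M (n + 1))) := by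
  have : AlgebraicGeometry.IsNoetherian X := hf.isNoetherian
  have h : NaiveBlowup.IsPointIdeal σ (NaiveBlowup.ofIdealSheaf I) :=
    NaiveBlowup.isPointIdeal_ofIdealSheaf hI hord
  exact ⟨NaiveBlowup.isRightNoetherian_naiveBlowup_iff hs h,
    NaiveBlowup.isNoetherian_naiveBlowup_iff hs h, NaiveBlowup.exists_chain_naiveBlowup hs h⟩
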